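/- Let $k$ be an algebraically closed field whose cardinality is strictly greater than that of the continuum. Varieties over $k$ are irreducible algebraic varieties in the sense of Serre's FAC: irreducible topological spaces $X$ with a sheaf of $k$-valued functions (the regular functions) that admit a finite open cover by subsets isomorphic to locally closed subsets of affine spaces over $k$, and whose diagonal is closed in the product variety $X\times X$. A variety is normal if all its local rings are integrally closed domains. A partial function $g\colon X\dashrightarrow k$ with domain of definition $\operatorname{dom} g\subseteq X$ is called a rational function on the variety $X$ if $\operatorname{dom} g$ is a dense Zariski open subset of $X$ and $g|_{\operatorname{dom} g}\colon \operatorname{dom} g\to k$ is a morphism of varieties to the affine line $k=k^1$ (that is, $g$ is regular on all of $\operatorname{dom} g$). Let $X$ be a normal variety over $k$ and let $f\colon X\times k\dashrightarrow k$ be a partial function whose domain of definition $\operatorname{dom} f$ is a nonempty Zariski open subset of the product variety $X\times k$. For $a\in X$ let $f_a\colon k\dashrightarrow k$ be the partial function $b\mapsto f(a,b)$ with domain $\{b\in k : (a,b)\in\operatorname{dom} f\}$, and for $b\in k$ let $f^b\colon X\dashrightarrow k$ be the partial function $a\mapsto f(a,b)$ with domain $\{a\in X : (a,b)\in\operatorname{dom}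 f\}$. If $f_a$ is a rational function on $k$ and $f^b$ is a rational function on $X$ for every $(a,b)\in\operatorname{dom} f$, then $f$ is a rational function on $X\times k$. -/

import Mathlib

open Filter Topology

/-- A set `X` with a topology and a subsheaf of `k`-algebras of the sheaf of germs of `k`-valued
functions on `X`. The stalk at `x` is a subring, containing the constants, of the ring of all germs at `x` of
functions `X → k`, and the union of the stalks is open in the étalé space. -/
structure FunctionSheaf (k : Type*) [Field k] (X : Type*) extends TopologicalSpace X where
  stalk (x : X) : Subring (Germ (@nhds X toTopologicalSpace x) k)
  const_mem_stalk (c : k) (x : X) :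
    ((fun _ => c : X → k) : Germ (@nhds X toTopologicalSpace x) k) ∈ stalk x
  eventually_mem_stalk (f : X → k) (x : X)
      (hf : (f : Germ (@nhds X toTopologicalSpace x) k) ∈ stalk x) :
    ∀ᶠ y in @nhds X toTopologicalSpace x, (f : Germ (@nhds X toTopologicalSpace y) k) ∈ stalk y

namespace FunctionSheaf

variable {k : Type*} [Field k] {X Y : Type*}

/-- The function `f` is regular at `x`. Only the values of `f` near `x` matter. -/
def RegularAt (S : FunctionSheaf k X) (f : X → k) (x : X) : Prop :=
  (f : Germ (@nhds X S.toTopologicalSpace x) k) ∈ S.stalk x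

/-- Morphisms: continuous maps that pull regular functions back to regular functions. -/
def IsMorphism (S : FunctionSheaf k X) (T : FunctionSheaf k Y) (φ : X → Y) : Prop :=
  @Continuous X Y S.toTopologicalSpace T.toTopologicalSpace φ ∧
    ∀ (x : X) (g : Y → k), T.RegularAt g (φ x) → S.RegularAt (g ∘ φ) x

/-- The structure induced on a subset `A`: the subspace topology, and germs of restrictions to `A`
of regular functions. -/
def restrict (S : FunctionSheaf k X) (A : Set X) : FunctionSheaf k A where
  toTopologicalSpace := S.toTopologicalSpace.induced Subtype.val
  stalk x :=
    { carrier := {γ | ∃ F : X → k, S.RegularAt F x ∧ γ = ((fun y : A => F y : A → k) : Germ _ k)}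
      mul_mem' := by
        rintro _ _ ⟨F, hF, rfl⟩ ⟨G, hG, rfl⟩
        exact ⟨F * G, (S.stalk x).mul_mem hF hG, rfl⟩
      add_mem' := by
        rintro _ _ ⟨F, hF, rfl⟩ ⟨G, hG, rfl⟩
        exact ⟨F + G, (S.stalk x).add_mem hF hG, rfl⟩
      one_mem' := ⟨1, (S.stalk x).one_mem, rfl⟩
      zero_mem' := ⟨0, (S.stalk x).zero_mem, rfl⟩
      neg_mem' := by
        rintro _ ⟨F, hF, rfl⟩
        exact ⟨-F, (S.stalk x).neg_mem hF, rfl⟩ }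
  const_mem_stalk c x := ⟨fun _ => c, S.const_mem_stalk c x, rfl⟩
  eventually_mem_stalk f x := by
    let := S.toTopologicalSpace
    rintro ⟨F, hF, hfF⟩
    have h1 : ∀ᶠ y in 𝓝 x, f y = F y := Germ.coe_eq.1 hfF
    have h2 : ∀ᶠ y : A in 𝓝 x, S.RegularAt F y :=
      continuous_subtype_val.continuousAt.eventually (S.eventually_mem_stalk F x hF)
    filter_upwards [h1.eventually_nhds, h2] with y hy1 hy2
    exact ⟨F, hy2, Germ.coe_eq.2 hy1⟩

/-- Germs along `l` of quotients `n / d` of functions of an algebra `A` with `d x ≠ 0`. -/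
def fractions (A : Subalgebra k (X → k)) (x : X) (l : Filter X)
    (hl : ∀ d ∈ A, d x ≠ 0 → ∀ᶠ y in l, d y ≠ 0) : Subring (Germ l k) where
  carrier := {γ | ∃ n ∈ A, ∃ d ∈ A, d x ≠ 0 ∧ γ = ((fun y => n y / d y : X → k) : Germ l k)}
  mul_mem' := by
    rintro _ _ ⟨n, hn, d, hd, hdx, rfl⟩ ⟨n', hn', d', hd', hdx', rfl⟩
    refine ⟨n * n', A.mul_mem hn hn', d * d', A.mul_mem hd hd', mul_ne_zero hdx hdx', ?_⟩
    refine Germ.coe_eq.2 (Eventually.of_forall fun y => ?_)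
    simp [div_mul_div_comm]
  add_mem' := by
    rintro _ _ ⟨n, hn, d, hd, hdx, rfl⟩ ⟨n', hn', d', hd', hdx', rfl⟩
    refine ⟨n * d' + d * n', A.add_mem (A.mul_mem hn hd') (A.mul_mem hd hn'), d * d',
      A.mul_mem hd hd', mul_ne_zero hdx hdx', ?_⟩
    refine Germ.coe_eq.2 ?_
    filter_upwards [hl d hd hdx, hl d' hd' hdx'] with y hy hy'
    simp [div_add_div _ _ hy hy']
  one_mem' := by
    refine ⟨1, A.one_mem, 1, A.one_mem, one_ne_zero, ?_⟩
    exact Germ.coe_eq.2 (Eventually.of_forall fun y => by simp)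
  zero_mem' := by
    refine ⟨0, A.zero_mem, 1, A.one_mem, one_ne_zero, ?_⟩
    exact Germ.coe_eq.2 (Eventually.of_forall fun y => by simp)
  neg_mem' := by
    rintro _ ⟨n, hn, d, hd, hdx, rfl⟩
    refine ⟨-n, A.neg_mem hn, d, hd, hdx, ?_⟩
    exact Germ.coe_eq.2 (Eventually.of_forall fun y => by simp [neg_div])

theorem const_mem_fractions (A : Subalgebra k (X → k)) (x : X) (l : Filter X)
    (hl : ∀ d ∈ A, d x ≠ 0 → ∀ᶠ y in l, d y ≠ 0) (c : k) :
    ((fun _ => c : X → k) : Germ l k) ∈ fractions A x l hl := by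
  refine ⟨fun _ => c, A.algebraMap_mem c, 1, A.one_mem, one_ne_zero, ?_⟩
  exact Germ.coe_eq.2 (Eventually.of_forall fun y => by simp)

/-- The topology on `X` whose basic open sets are the sets `{d ≠ 0}` with `d ∈ A`. -/
@[reducible] def algebraTopology (A : Subalgebra k (X → k)) : TopologicalSpace X :=
  TopologicalSpace.generateFrom {V | ∃ d ∈ A, V = {x | d x ≠ 0}}

theorem eventually_algebraTopology (A : Subalgebra k (X → k)) (x : X) (d : X → k) (hd : d ∈ A)
    (hdx : d x ≠ 0) : ∀ᶠ y in @nhds X (algebraTopology A) x, d y ≠ 0 := by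
  let := algebraTopology A
  exact IsOpen.mem_nhds (TopologicalSpace.isOpen_generateFrom_of_mem ⟨d, hd, rfl⟩) hdx

/-- The structure on `X` given by an algebra `A` of functions: its topology is `algebraTopology A`,
and the regular functions are locally quotients of elements of `A`. -/
def ofAlgebra (A : Subalgebra k (X → k)) : FunctionSheaf k X where
  toTopologicalSpace := algebraTopology A
  stalk x := fractions A x (@nhds X (algebraTopology A) x) (eventually_algebraTopology A x)
  const_mem_stalk c x := const_mem_fractions _ _ _ _ c
  eventually_mem_stalk f x := by
    let := algebraTopology A
    rintro ⟨n, hn, d, hd, hdx, hf⟩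
    have h1 : ∀ᶠ y in 𝓝 x, f y = n y / d y := Germ.coe_eq.1 hf
    filter_upwards [h1.eventually_nhds, eventually_algebraTopology A x d hd hdx] with y hy1 hy2
    exact ⟨n, hn, d, hd, hy2, Germ.coe_eq.2 hy1⟩

/-- Affine space `k ^ n` with its Zariski topology and its sheaf of regular functions, both
defined by the algebra of polynomial functions. -/
noncomputable def affineSpace (k : Type*) [Field k] (n : ℕ) : FunctionSheaf k (Fin n → k) :=
  ofAlgebra (MvPolynomial.aeval fun (i : Fin n) (x : Fin n → k) => x i).range

/-- The affine line `k`. -/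
noncomputable def affineLine (k : Type*) [Field k] : FunctionSheaf k k :=
  ofAlgebra (Polynomial.aeval (id : k → k)).range

/-- The algebra of functions `(x, y) ↦ ∑ gᵢ x * hᵢ y` (finite sums), where the `gᵢ` are regular at
all points of `V` and the `hᵢ` are regular at all points of `W`. -/
def tensorOn (S : FunctionSheaf k X) (T : FunctionSheaf k Y) (V : Set X) (W : Set Y) :
    Subalgebra k (X × Y → k) :=
  Algebra.adjoin k
    ({F | ∃ g : X → k, (∀ x ∈ V, S.RegularAt g x) ∧ F = g ∘ Prod.fst} ∪
      {F | ∃ h : Y → k, (∀ y ∈ W, T.RegularAt h y) ∧ F = h ∘ Prod.snd})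

theorem tensorOn_anti (S : FunctionSheaf k X) (T : FunctionSheaf k Y) {V V' : Set X} {W W' : Set Y}
    (hV : V' ⊆ V) (hW : W' ⊆ W) : S.tensorOn T V W ≤ S.tensorOn T V' W' := by
  refine Algebra.adjoin_mono (Set.union_subset_union ?_ ?_)
  · rintro _ ⟨g, hg, rfl⟩
    exact ⟨g, fun x hx => hg x (hV hx), rfl⟩
  · rintro _ ⟨g, hg, rfl⟩
    exact ⟨g, fun x hx => hg x (hW hx), rfl⟩

theorem exists_mem_tensorOn (S : FunctionSheaf k X) (T : FunctionSheaf k Y) (p : X × Y)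
    {F : X × Y → k} (hF : F ∈ S.tensorOn T {p.1} {p.2}) :
    ∃ V W, IsOpen[S.toTopologicalSpace] V ∧ IsOpen[T.toTopologicalSpace] W ∧ p.1 ∈ V ∧ p.2 ∈ W ∧
      F ∈ S.tensorOn T V W := by
  let := S.toTopologicalSpace
  let := T.toTopologicalSpace
  induction hF using Algebra.adjoin_induction with
  | mem F hF =>
    rcases hF with ⟨g, hg, rfl⟩ | ⟨g, hg, rfl⟩
    · obtain ⟨V, hV, hVo, hpV⟩ := eventually_nhds_iff.1 (S.eventually_mem_stalk g p.1 (hg _ rfl))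
      exact ⟨V, Set.univ, hVo, isOpen_univ, hpV, trivial,
        Algebra.subset_adjoin (Or.inl ⟨g, hV, rfl⟩)⟩
    · obtain ⟨W, hW, hWo, hpW⟩ := eventually_nhds_iff.1 (T.eventually_mem_stalk g p.2 (hg _ rfl))
      exact ⟨Set.univ, W, isOpen_univ, hWo, trivial, hpW,
        Algebra.subset_adjoin (Or.inr ⟨g, hW, rfl⟩)⟩
  | algebraMap c =>
    exact ⟨Set.univ, Set.univ, isOpen_univ, isOpen_univ, trivial, trivial,
      Subalgebra.algebraMap_mem _ c⟩
  | add F G _ _ hF hG =>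
    obtain ⟨V, W, hV, hW, hpV, hpW, h⟩ := hF
    obtain ⟨V', W', hV', hW', hpV', hpW', h'⟩ := hG
    exact ⟨V ∩ V', W ∩ W', hV.inter hV', hW.inter hW', ⟨hpV, hpV'⟩, ⟨hpW, hpW'⟩,
      Subalgebra.add_mem _
        (tensorOn_anti S T Set.inter_subset_left Set.inter_subset_left h)
        (tensorOn_anti S T Set.inter_subset_right Set.inter_subset_right h')⟩
  | mul F G _ _ hF hG =>
    obtain ⟨V, W, hV, hW, hpV, hpW, h⟩ := hF
    obtain ⟨V', W', hV', hW', hpV', hpW', h'⟩ := hG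
    exact ⟨V ∩ V', W ∩ W', hV.inter hV', hW.inter hW', ⟨hpV, hpV'⟩, ⟨hpW, hpW'⟩,
      Subalgebra.mul_mem _
        (tensorOn_anti S T Set.inter_subset_left Set.inter_subset_left h)
        (tensorOn_anti S T Set.inter_subset_right Set.inter_subset_right h')⟩

/-- The Zariski topology of the product: the basic open sets are `{p ∈ V × W | F p ≠ 0}` with
`V`, `W` open and `F` a finite sum of products of a regular function on `V` and one on `W`. -/
@[reducible] def prodTopology (S : FunctionSheaf k X) (T : FunctionSheaf k Y) : TopologicalSpace (X × Y) :=
  TopologicalSpace.generateFrom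
    {O | ∃ V W, IsOpen[S.toTopologicalSpace] V ∧ IsOpen[T.toTopologicalSpace] W ∧
      ∃ F ∈ S.tensorOn T V W, O = {p | p.1 ∈ V ∧ p.2 ∈ W ∧ F p ≠ 0}}

theorem eventually_prodTopology (S : FunctionSheaf k X) (T : FunctionSheaf k Y) (p : X × Y)
    {V : Set X} {W : Set Y} {F : X × Y → k} (hV : IsOpen[S.toTopologicalSpace] V)
    (hW : IsOpen[T.toTopologicalSpace] W) (hF : F ∈ S.tensorOn T V W)
    (hpV : p.1 ∈ V) (hpW : p.2 ∈ W) (hp : F p ≠ 0) :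
    ∀ᶠ q in @nhds _ (S.prodTopology T) p, q.1 ∈ V ∧ q.2 ∈ W ∧ F q ≠ 0 := by
  let := S.prodTopology T
  exact IsOpen.mem_nhds (TopologicalSpace.isOpen_generateFrom_of_mem ⟨V, W, hV, hW, F, hF, rfl⟩)
    ⟨hpV, hpW, hp⟩

/-- The product of `S` and `T`: it has the topology `prodTopology`, and its regular functions are
locally quotients of finite sums of products of regular functions of the two variables. -/
def prod (S : FunctionSheaf k X) (T : FunctionSheaf k Y) : FunctionSheaf k (X × Y) where
  toTopologicalSpace := S.prodTopology T
  stalk p := fractions (S.tensorOn T {p.1} {p.2}) p (@nhds _ (S.prodTopology T) p) (by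
    intro d hd hdp
    obtain ⟨V, W, hV, hW, hpV, hpW, h⟩ := exists_mem_tensorOn S T p hd
    filter_upwards [eventually_prodTopology S T p hV hW h hpV hpW hdp] with q hq using hq.2.2)
  const_mem_stalk c x := const_mem_fractions _ _ _ _ c
  eventually_mem_stalk f p := by
    let := S.prodTopology T
    rintro ⟨n, hn, d, hd, hdp, hf⟩
    have h1 : ∀ᶠ q in 𝓝 p, f q = n q / d q := Germ.coe_eq.1 hf
    obtain ⟨V, W, hV, hW, hpV, hpW, h⟩ := exists_mem_tensorOn S T p hd
    obtain ⟨V', W', hV', hW', hpV', hpW', h'⟩ := exists_mem_tensorOn S T p hn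
    filter_upwards [h1.eventually_nhds, eventually_prodTopology S T p hV hW h hpV hpW hdp,
      eventually_prodTopology S T p hV' hW' (Subalgebra.one_mem _) hpV' hpW' one_ne_zero]
      with q hq hq1 hq2
    exact ⟨n, tensorOn_anti S T (Set.singleton_subset_iff.2 hq2.1)
        (Set.singleton_subset_iff.2 hq2.2.1) h', d,
      tensorOn_anti S T (Set.singleton_subset_iff.2 hq1.1) (Set.singleton_subset_iff.2 hq1.2.1) h,
      hq1.2.2, Germ.coe_eq.2 hq⟩

/-- (Irreducible) algebraic varieties in the sense of Serre's FAC: `X` has a finite open cover by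
subsets isomorphic to locally closed subsets of affine spaces, the diagonal is closed in
`X × X`, and `X` is irreducible. -/
structure IsVariety (S : FunctionSheaf k X) : Prop where
  exists_charts : ∃ (m : ℕ) (V : Fin m → Set X),
    (∀ i, IsOpen[S.toTopologicalSpace] (V i)) ∧ (⋃ i, V i) = Set.univ ∧
    ∀ i, ∃ (n : ℕ) (U : Set (Fin n → k)),
      @IsLocallyClosed _ (affineSpace k n).toTopologicalSpace U ∧
      ∃ e : V i ≃ U, IsMorphism (S.restrict (V i)) ((affineSpace k n).restrict U) e ∧
        IsMorphism ((affineSpace k n).restrict U) (S.restrict (V i)) e.symm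
  isClosed_diagonal : IsClosed[(S.prod S).toTopologicalSpace] (Set.diagonal X)
  irreducible : @IrreducibleSpace X S.toTopologicalSpace

/-- Normality: every local ring is an integrally closed domain. -/
def IsNormal (S : FunctionSheaf k X) : Prop :=
  ∀ x, IsDomain (S.stalk x) ∧ IsIntegrallyClosed (S.stalk x)

/-- A partial function is a rational map if its domain is a dense open set on which it is a
morphism. -/
def IsRationalMap (S : FunctionSheaf k X) (T : FunctionSheaf k Y) (f : X →. Y) : Prop :=
  IsOpen[S.toTopologicalSpace] f.Dom ∧ @Dense X S.toTopologicalSpace f.Dom ∧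
    IsMorphism (S.restrict f.Dom) T f.asSubtype

/-- Rational functions are rational maps to the affine line. -/
def IsRationalFunction (S : FunctionSheaf k X) (f : X →. k) : Prop :=
  IsRationalMap S (affineLine k) f

end FunctionSheaf

/-- The slice `f_a : b ↦ f (a, b)`, defined where `(a, b) ∈ dom f`. -/
def PFun.sliceFst {A B C : Type*} (f : A × B →. C) (a : A) : B →. C := fun b => f (a, b)

/-- The slice `f^b : a ↦ f (a, b)`, defined where `(a, b) ∈ dom f`. -/
def PFun.sliceSnd {A B C : Type*} (f : A × B →. C) (b : B) : A →. C := fun a => f (a, b)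

/-! Regularity is local on `X`, so `X` may be replaced by an affine chart with coordinate ring `A`,
a finitely generated integrally closed domain whose characters are its points. Over it, `f` is a
function on an open set `U` that is regular in each variable separately.

First, `f` is a fraction `P / Q` with `P`, `Q` in `A[X]` (`SeparatelyRegular.exists_rational`).
Writing `f^b = n_b / d_b`, one solves `n_b Q(b) = d_b P(b)` for all `b` at once, a linear system in
the coefficients of `P` and `Q`. If it had no nonzero solution in any degree, there would be one
nonzero determinant for each degree bound. As `k` is uncountable, some point of the chart avoids the
zeros of all these countably many determinants (`exists_algHom_forall_ne_zero`), yet the slice of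
`f` over that point is a quotient of polynomials of some bounded degree, which makes one of them
vanish.

Second, an identity between multiples of `P / Q` holds for `f` at every point of `U`, not only
generically (`SeparatelyRegular.cancel`): cancel in the slices `f^b`, then cross the finitely many
bad `b` by regularity of `f_a`.

Third, `A[X]` is Noetherian and integrally closed. If `P / Q` is not regular at a point of `U`, then
some multiple of it has a pole along an irreducible subset through that point
(`exists_prime_denominators`). That subset meets `U` in points where the second step gives `0 = u`
with `u` nonzero. -/

/-! ### Points avoiding countably many hypersurfaces, and linear algebra over a domain -/

/-- A field extension of an algebraically closed uncountable field that is generated, as an algebra,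
by a countable set is trivial. -/
theorem IsAlgClosed.algebraMap_surjective_of_countable {k L : Type*} [Field k] [IsAlgClosed k]
    (hk : Cardinal.aleph0 < Cardinal.mk k) [Field L] [Algebra k L] {s : Set L} (hs : s.Countable)
    (hadj : Algebra.adjoin k s = ⊤) : Function.Surjective (algebraMap k L) := by
  have hrank : Module.rank k L ≤ Cardinal.aleph0 := by
    have h := Algebra.rank_adjoin_le (R := k) s
    rw [hadj, max_eq_right hs.le_aleph0] at h
    exact (LinearEquiv.rank_eq (Subalgebra.topEquiv (R := k) (A := L)).toLinearEquiv).symm.trans_le h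
  have halg : Algebra.IsAlgebraic k L := by
    refine ⟨fun x => ?_⟩
    by_contra hx
    -- The elements `1 / (x - c)`, one for each `c` in `k`, are too many to be independent in
    -- countable dimension.
    have h := (show Transcendental k x from hx).linearIndependent_sub_inv.cardinal_lift_le_rank
    have h' := h.trans (Cardinal.lift_le.2 hrank)
    rw [Cardinal.lift_aleph0, Cardinal.lift_le_aleph0] at h'
    exact absurd hk (not_lt.2 h')
  have : Algebra.IsIntegral k L := inferInstance
  exact (IsAlgClosed.algebraMap_bijective_of_isIntegral (k := k) (K := L)).2

/-- Countably many nonzero regular functions on an irreducible affine variety over an uncountable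
algebraically closed field have a common point of nonvanishing. -/
theorem exists_algHom_forall_ne_zero {k D ι : Type*} [Field k] [IsAlgClosed k]
    (hk : Cardinal.aleph0 < Cardinal.mk k) [CommRing D] [IsDomain D] [Algebra k D]
    [Algebra.FiniteType k D] [Countable ι] (g : ι → D) (hg : ∀ i, g i ≠ 0) :
    ∃ φ : D →ₐ[k] k, ∀ i, φ (g i) ≠ 0 := by
  let M : Submonoid D := Submonoid.closure (Set.range g)
  have hM : M ≤ nonZeroDivisors D := by
    rw [Submonoid.closure_le]
    rintro _ ⟨i, rfl⟩
    exact mem_nonZeroDivisors_of_ne_zero (hg i)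
  have : Nontrivial (Localization M) := (IsLocalization.injective (Localization M) hM).nontrivial
  obtain ⟨m, hm⟩ := Ideal.exists_maximal (Localization M)
  let L := Localization M ⧸ m
  let : Field L := Ideal.Quotient.field m
  let ψ : D →ₐ[k] L := (Ideal.Quotient.mkₐ k m).comp (IsScalarTower.toAlgHom k D (Localization M))
  have hψM : ∀ y ∈ M, ψ y ≠ 0 := fun y hy =>
    (((IsLocalization.map_units (Localization M) ⟨y, hy⟩).map (Ideal.Quotient.mk m))).ne_zero
  obtain ⟨t, ht⟩ := (‹Algebra.FiniteType k D›).out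
  -- Inverting each `g i` already inverts all of `M`, so the residue field `L` is countably
  -- generated and therefore equal to `k`.
  let s : Set L := ψ '' t ∪ Set.range fun i => (ψ (g i))⁻¹
  have hψ : ∀ d, ψ d ∈ Algebra.adjoin k s := by
    intro d
    have h1 : ψ d ∈ (Algebra.adjoin k (t : Set D)).map ψ := ⟨d, by simp [ht], rfl⟩
    rw [AlgHom.map_adjoin] at h1
    exact Algebra.adjoin_mono Set.subset_union_left h1
  have hinv : ∀ y ∈ M, (ψ y)⁻¹ ∈ Algebra.adjoin k s := by
    intro y hy
    induction hy using Submonoid.closure_induction with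
    | mem y hy =>
      obtain ⟨i, rfl⟩ := hy
      exact Algebra.subset_adjoin (Or.inr ⟨i, rfl⟩)
    | one => simp
    | mul x y _ _ hx hy => simpa [mul_inv] using Subalgebra.mul_mem _ hy hx
  have hadj : Algebra.adjoin k s = ⊤ := by
    rw [eq_top_iff]
    rintro z -
    obtain ⟨z, rfl⟩ := Ideal.Quotient.mk_surjective z
    obtain ⟨⟨a, y⟩, h⟩ := IsLocalization.surj M z
    have h' : Ideal.Quotient.mk m z = ψ a * (ψ y)⁻¹ := by
      rw [eq_mul_inv_iff_mul_eq₀ (hψM y y.2)]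
      exact congrArg (Ideal.Quotient.mk m) h
    rw [h']
    exact Subalgebra.mul_mem _ (hψ a) (hinv y y.2)
  have hs : s.Countable := (t.countable_toSet.image ψ).union (Set.countable_range _)
  have hsurj := IsAlgClosed.algebraMap_surjective_of_countable hk hs hadj
  let e : k ≃ₐ[k] L := AlgEquiv.ofBijective (Algebra.ofId k L) ⟨(algebraMap k L).injective, hsurj⟩
  refine ⟨(e.symm : L →ₐ[k] k).comp ψ, fun i h => ?_⟩
  exact hψM (g i) (Submonoid.subset_closure ⟨i, rfl⟩) (by simpa using h)

/-- Nullstellensatz: a regular function outside a prime ideal is nonzero at a point of its zero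
locus. -/
theorem Ideal.IsPrime.exists_algHom_ne_zero {k D : Type*} [Field k] [IsAlgClosed k]
    (hk : Cardinal.aleph0 < Cardinal.mk k) [CommRing D] [Algebra k D] [Algebra.FiniteType k D]
    {p : Ideal D} (hp : p.IsPrime) {s : D} (hs : s ∉ p) :
    ∃ φ : D →ₐ[k] k, (∀ r ∈ p, φ r = 0) ∧ φ s ≠ 0 := by
  obtain ⟨φ, hφ⟩ := exists_algHom_forall_ne_zero (k := k) (D := D ⧸ p) hk
    (fun _ : Unit => Ideal.Quotient.mk p s) (fun _ => by rwa [Ne, Ideal.Quotient.eq_zero_iff_mem])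
  refine ⟨φ.comp (Ideal.Quotient.mkₐ k p), fun r hr => ?_, hφ ()⟩
  simp [Ideal.Quotient.eq_zero_iff_mem.2 hr]

/-- A family of vectors over a domain either has a nonzero common orthogonal vector or contains a
square subfamily with nonzero determinant. -/
theorem exists_dotProduct_eq_zero_or_exists_det_ne_zero {A E ι : Type*} [CommRing A] [IsDomain A]
    [Fintype ι] [DecidableEq ι] (r : E → ι → A) :
    (∃ c : ι → A, c ≠ 0 ∧ ∀ e, r e ⬝ᵥ c = 0) ∨
      ∃ e : ι → E, (Matrix.of fun i => r (e i)).det ≠ 0 := by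
  let K := FractionRing A
  let v : E → ι → K := fun e i => algebraMap A K (r e i)
  -- Over the fraction field the vectors either span, and so contain a basis, or lie in a
  -- hyperplane, whose equation becomes integral after clearing denominators.
  by_cases hspan : Submodule.span K (Set.range v) = ⊤
  · right
    obtain ⟨s, hs, hsp, hli⟩ := exists_linearIndependent K (Set.range v)
    have hb : Module.Basis s K (ι → K) := Module.Basis.mk hli (by
      rw [Subtype.range_coe, hsp, hspan])
    have : Fintype s := Module.Basis.fintypeIndexOfRankLtAleph0 hb (Module.rank_lt_aleph0 K _)
    have hcard : Fintype.card ι = Fintype.card s := by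
      rw [← Module.finrank_eq_card_basis hb, Module.finrank_fintype_fun_eq_card]
    let σ : ι ≃ s := Fintype.equivOfCardEq hcard
    choose e he using fun x : s => hs x.2
    refine ⟨fun i => e (σ i), fun hdet => ?_⟩
    have hli' : LinearIndependent K (fun i => ((σ i : s) : ι → K)) := hli.comp σ σ.injective
    have hrow : (fun i => ((σ i : s) : ι → K)) =
        (Matrix.of fun i => r (e (σ i))).map (algebraMap A K) := by
      funext i
      rw [← he (σ i)]
      rfl
    rw [hrow] at hli'
    have hu := Matrix.linearIndependent_rows_iff_isUnit.1 hli'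
    rw [Matrix.isUnit_iff_isUnit_det] at hu
    have h0 := RingHom.map_det (algebraMap A K) (Matrix.of fun i => r (e (σ i)))
    rw [hdet, map_zero] at h0
    rw [RingHom.mapMatrix_apply] at h0
    exact hu.ne_zero h0.symm
  · left
    obtain ⟨φ, hφ, hle⟩ := Submodule.exists_le_ker_of_lt_top _ (lt_top_iff_ne_top.2 hspan)
    let c : ι → K := fun i => φ fun j => if i = j then 1 else 0
    have hφc : ∀ x : ι → K, φ x = x ⬝ᵥ c := by
      intro x
      rw [LinearMap.pi_apply_eq_sum_univ φ x]
      simp [dotProduct, c]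
    obtain ⟨b, hb⟩ := IsLocalization.exist_integer_multiples_of_finite (nonZeroDivisors A) c
    choose c' hc' using hb
    have hb0 : algebraMap A K b ≠ 0 := by simp
    refine ⟨c', ?_, fun e => ?_⟩
    · rintro rfl
      apply hφ
      have hc0 : c = 0 := by
        funext i
        have h := hc' i
        rw [Pi.zero_apply, map_zero, Algebra.smul_def] at h
        exact (mul_eq_zero.1 h.symm).resolve_left hb0
      ext x
      simp [hc0, hφc]
    · have h1 : v e ⬝ᵥ c = 0 := by
        rw [← hφc]
        exact hle (Submodule.subset_span ⟨e, rfl⟩)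
      apply IsFractionRing.injective A K
      rw [map_zero]
      have : algebraMap A K (r e ⬝ᵥ c') = algebraMap A K b * (v e ⬝ᵥ c) := by
        simp only [dotProduct, map_sum, map_mul, hc', Finset.mul_sum, v, Algebra.smul_def]
        exact Finset.sum_congr rfl fun i _ => by ring
      rw [this, h1, mul_zero]

/-! ### Separately regular functions over an affine variety -/

section SeparatelyRegular

open Polynomial

variable {k A : Type*} [Field k] [CommRing A] [Algebra k A]

/-- Evaluation of an element of `A[X]` at the point `(χ, b)` of the product of the affine variety
of `A` and the affine line. -/
noncomputable def evalPair (χ : A →ₐ[k] k) (b : k) : A[X] →ₐ[k] k where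
  __ := eval₂RingHom (χ : A →+* k) b
  commutes' c := by simp [Polynomial.algebraMap_apply]

@[simp] theorem evalPair_C (χ : A →ₐ[k] k) (b : k) (a : A) : evalPair χ b (C a) = χ a := by
  change eval₂ (χ : A →+* k) b _ = _
  simp

@[simp] theorem evalPair_X (χ : A →ₐ[k] k) (b : k) : evalPair χ b X = b := by
  change eval₂ (χ : A →+* k) b _ = _
  simp

theorem evalPair_eq_eval_map (χ : A →ₐ[k] k) (b : k) (w : A[X]) :
    evalPair χ b w = (w.map (χ : A →+* k)).eval b := by
  rw [eval_map]; rfl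

theorem evalPair_eq_apply_eval (χ : A →ₐ[k] k) (b : k) (w : A[X]) :
    evalPair χ b w = χ (w.eval (algebraMap k A b)) := by
  have h : evalPair χ b = χ.comp ((aeval (algebraMap k A b)).restrictScalars k) := by
    ext <;> simp
  rw [h]
  simp

/-- Characters of `A[X]` are exactly the points of the product, so the Nullstellensatz for `A[X]`
produces pairs `(χ, b)`. -/
theorem evalPair_comp (φ : A[X] →ₐ[k] k) :
    evalPair (φ.comp CAlgHom) (φ X) = φ := by
  ext <;> simp

/-- A function `f` on a subset `U` of the product of the affine variety of `A` and the affine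
line, where `U` is open and `f` is regular in each variable separately. Regularity at a point is
expressed by a quotient `n / d` that represents the function near this point. -/
structure SeparatelyRegular (U : Set ((A →ₐ[k] k) × k)) (f : (A →ₐ[k] k) → k → k) : Prop where
  isOpen : ∀ χ b, (χ, b) ∈ U →
    ∃ w : A[X], evalPair χ b w ≠ 0 ∧ ∀ χ' b', evalPair χ' b' w ≠ 0 → (χ', b') ∈ U
  fst : ∀ χ b, (χ, b) ∈ U →
    ∃ n d : A, χ d ≠ 0 ∧ ∀ χ', (χ', b) ∈ U → χ' d * f χ' b = χ' n
  snd : ∀ χ b, (χ, b) ∈ U →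
    ∃ n d : k[X], d.eval b ≠ 0 ∧ ∀ b', (χ, b') ∈ U → d.eval b' * f χ b' = n.eval b'

namespace SeparatelyRegular

variable {U : Set ((A →ₐ[k] k) × k)} {f : (A →ₐ[k] k) → k → k}

theorem exists_slice (h : SeparatelyRegular U f) {χ : A →ₐ[k] k} {b : k} (hU : (χ, b) ∈ U) :
    ∃ s : A, χ s ≠ 0 ∧ ∀ χ' : A →ₐ[k] k, χ' s ≠ 0 → (χ', b) ∈ U := by
  obtain ⟨w, hw, hw'⟩ := h.isOpen χ b hU
  refine ⟨w.eval (algebraMap k A b), by rwa [← evalPair_eq_apply_eval], fun χ' h' => ?_⟩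
  exact hw' χ' b (by rwa [evalPair_eq_apply_eval])

/-- On the line over `χ` the polynomial `w` is nonzero and has finitely many roots. The set `s`
leaves room to discard finitely many further values. -/
theorem infinite_slice [Infinite k] (h : SeparatelyRegular U f) {χ : A →ₐ[k] k} {b : k}
    (hU : (χ, b) ∈ U) (s : Set k) (hs : s.Finite) : {b' | b' ∉ s ∧ (χ, b') ∈ U}.Infinite := by
  obtain ⟨w, hw, hw'⟩ := h.isOpen χ b hU
  have hw0 : w.map (χ : A →+* k) ≠ 0 := by
    intro h0
    rw [evalPair_eq_eval_map, h0, eval_zero] at hw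
    exact hw rfl
  have hfin := (finite_setOfPred_isRoot hw0).union hs
  refine hfin.infinite_compl.mono fun b' hb' => ?_
  simp only [Set.mem_compl_iff, Set.mem_union, not_or] at hb'
  exact ⟨hb'.2, hw' χ b' (by rw [evalPair_eq_eval_map]; exact hb'.1)⟩

variable [IsAlgClosed k] [IsDomain A] [Algebra.FiniteType k A]

/-- Elements of a finitely generated domain that agree at all points with `s ≠ 0` are equal. -/
theorem eq_of_forall_algHom (hk : Cardinal.aleph0 < Cardinal.mk k) {s x y : A} (hs : s ≠ 0)
    (hxy : ∀ χ : A →ₐ[k] k, χ s ≠ 0 → χ x = χ y) : x = y := by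
  by_contra hne
  obtain ⟨χ, hχ⟩ := exists_algHom_forall_ne_zero (k := k) hk (fun _ : Unit => s * (x - y))
    (fun _ => mul_ne_zero hs (sub_ne_zero.2 hne))
  have h := hχ ()
  rw [map_mul, map_sub] at h
  exact h (by rw [hxy χ (left_ne_zero_of_mul h), sub_self, mul_zero])

/-- The slice contains a nonempty principal open set, and in a domain such a set determines the
fraction. -/
theorem fst_unique (hk : Cardinal.aleph0 < Cardinal.mk k) (h : SeparatelyRegular U f)
    {χ : A →ₐ[k] k} {b : k} (hU : (χ, b) ∈ U) {n d n' d' : A}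
    (hd : ∀ χ', (χ', b) ∈ U → χ' d * f χ' b = χ' n)
    (hd' : ∀ χ', (χ', b) ∈ U → χ' d' * f χ' b = χ' n') : n * d' = n' * d := by
  obtain ⟨s, hs, hs'⟩ := h.exists_slice hU
  refine eq_of_forall_algHom hk (s := s) (by rintro rfl; simp at hs) fun χ' hχ' => ?_
  rw [map_mul, map_mul, ← hd χ' (hs' χ' hχ'), ← hd' χ' (hs' χ' hχ')]
  ring

/-- A separately regular function is a quotient of two polynomials. -/
theorem exists_rational (hk : Cardinal.aleph0 < Cardinal.mk k) (h : SeparatelyRegular U f)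
    (hne : U.Nonempty) :
    ∃ P Q : A[X], Q ≠ 0 ∧ ∀ χ b, (χ, b) ∈ U → evalPair χ b Q * f χ b = evalPair χ b P := by
  obtain ⟨⟨χ₀, b₀⟩, hU₀⟩ := hne
  let E := {b : k // ∃ χ, (χ, b) ∈ U}
  have hE : Infinite E :=
    Set.infinite_coe_iff.2 ((h.infinite_slice hU₀ ∅ Set.finite_empty).mono fun b hb => ⟨χ₀, hb.2⟩)
  have hfst : ∀ b : E, ∃ n d : A, d ≠ 0 ∧ ∀ χ', (χ', b.1) ∈ U → χ' d * f χ' b = χ' n := by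
    rintro ⟨b, χ, hU⟩
    obtain ⟨n, d, hd, h'⟩ := h.fst χ b hU
    exact ⟨n, d, by rintro rfl; simp at hd, h'⟩
  choose n d hd hnd using hfst
  have hslice : ∀ b : E, ∃ s : A, s ≠ 0 ∧ ∀ χ' : A →ₐ[k] k, χ' s ≠ 0 → (χ', b.1) ∈ U := by
    rintro ⟨b, χ, hU⟩
    obtain ⟨s, hs, hs'⟩ := h.exists_slice hU
    exact ⟨s, by rintro rfl; simp at hs, hs'⟩
  choose s hs hsU using hslice
  -- Orthogonality to `c = (-P, Q)`, read as coefficients in degrees at most `N`, is the equation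
  -- `n_b Q(b) = d_b P(b)`.
  let r (N : ℕ) (b : E) : Fin (N + 1) ⊕ Fin (N + 1) → A :=
    Sum.elim (fun j => d b * algebraMap k A b ^ (j : ℕ)) fun j => n b * algebraMap k A b ^ (j : ℕ)
  have hr : ∃ N, ∃ c : Fin (N + 1) ⊕ Fin (N + 1) → A, c ≠ 0 ∧ ∀ b, r N b ⬝ᵥ c = 0 := by
    by_contra! hcon
    have hdet : ∀ N, ∃ e : Fin (N + 1) ⊕ Fin (N + 1) → E,
        (Matrix.of fun i => r N (e i)).det ≠ 0 := fun N =>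
      (exists_dotProduct_eq_zero_or_exists_det_ne_zero (r N)).resolve_left fun ⟨c, hc, hc'⟩ => by
        obtain ⟨b, hb⟩ := hcon N c hc
        exact hb (hc' b)
    choose e he using hdet
    -- Besides the determinants, the `s` of all chosen points must survive, so that these points lie
    -- in the slice of `U` over `χ`.
    obtain ⟨χ, hχ⟩ := exists_algHom_forall_ne_zero (k := k) hk
      (Sum.elim (fun N => (Matrix.of fun i => r N (e N i)).det)
        (fun p : Σ N, Fin (N + 1) ⊕ Fin (N + 1) => s (e p.1 p.2)))
      (by rintro (N | p); exacts [he N, hs _])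
    have hχU : ∀ N i, (χ, (e N i).1) ∈ U := fun N i => hsU _ χ (hχ (Sum.inr ⟨N, i⟩))
    obtain ⟨p, q, hq, hpq⟩ := h.snd χ _ (hχU 0 (Sum.inl 0))
    let N := max p.natDegree q.natDegree
    let c : Fin (N + 1) ⊕ Fin (N + 1) → k :=
      Sum.elim (fun j => -p.coeff j) fun j => q.coeff j
    have hc : c ≠ 0 := by
      intro h0
      have hq0 : q = 0 := by
        rw [← leadingCoeff_eq_zero]
        exact congrFun h0 (Sum.inr ⟨q.natDegree, Nat.lt_succ_of_le (le_max_right _ _)⟩)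
      rw [hq0, eval_zero] at hq
      exact hq rfl
    have hp' : ∀ x : k, ∑ j : Fin (N + 1), p.coeff j * x ^ (j : ℕ) = p.eval x := fun x => by
      rw [eval_eq_sum_range' (Nat.lt_succ_of_le (le_max_left p.natDegree q.natDegree)),
        Finset.sum_range]
    have hq' : ∀ x : k, ∑ j : Fin (N + 1), q.coeff j * x ^ (j : ℕ) = q.eval x := fun x => by
      rw [eval_eq_sum_range' (Nat.lt_succ_of_le (le_max_right p.natDegree q.natDegree)),
        Finset.sum_range]
    refine hχ (Sum.inl N) ?_
    have hmap := AlgHom.map_det χ (Matrix.of fun i => r N (e N i))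
    rw [Sum.elim_inl, hmap]
    -- The slice over `χ` is `p / q`, so `(-p, q)` is in the kernel of the matrix evaluated at `χ`.
    refine Matrix.exists_mulVec_eq_zero_iff.1 ⟨c, hc, ?_⟩
    funext i
    have h1 := hpq _ (hχU N i)
    have h2 := hnd _ χ (hχU N i)
    have h3 : ∑ j : Fin (N + 1), χ (d (e N i)) * (e N i : k) ^ (j : ℕ) * -p.coeff j =
        -(χ (d (e N i)) * p.eval (e N i : k)) := by
      rw [← hp', Finset.mul_sum, ← Finset.sum_neg_distrib]
      exact Finset.sum_congr rfl fun j _ => by ring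
    have h4 : ∑ j : Fin (N + 1), χ (n (e N i)) * (e N i : k) ^ (j : ℕ) * q.coeff j =
        χ (n (e N i)) * q.eval (e N i : k) := by
      rw [← hq', Finset.mul_sum]
      exact Finset.sum_congr rfl fun j _ => by ring
    simp only [Matrix.mulVec, dotProduct, Fintype.sum_sum_type, c, r, AlgHom.mapMatrix_apply,
      Matrix.map_apply, Matrix.of_apply, Sum.elim_inl, Sum.elim_inr, map_mul, map_pow,
      AlgHom.commutes, Algebra.algebraMap_self, RingHom.id_apply, Pi.zero_apply]
    rw [h3, h4, ← h1, ← h2]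
    ring
  obtain ⟨N, c, hc, hrc⟩ := hr
  let P : A[X] := ∑ j : Fin (N + 1), monomial (j : ℕ) (-c (Sum.inl j))
  let Q : A[X] := ∑ j : Fin (N + 1), monomial (j : ℕ) (c (Sum.inr j))
  have hPc : ∀ j : Fin (N + 1), P.coeff j = -c (Sum.inl j) := fun j => by
    simp [P, coeff_monomial, Fin.val_inj]
  have hQc : ∀ j : Fin (N + 1), Q.coeff j = c (Sum.inr j) := fun j => by
    simp [Q, coeff_monomial, Fin.val_inj]
  have hPQ : ∀ b : E, n b * Q.eval (algebraMap k A b) = d b * P.eval (algebraMap k A b) := by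
    intro b
    have h0 := hrc b
    simp only [r, dotProduct, Fintype.sum_sum_type, Sum.elim_inl, Sum.elim_inr] at h0
    simp only [P, Q, eval_finsetSum, eval_monomial, Finset.mul_sum]
    rw [← sub_eq_zero]
    refine Eq.trans ?_ h0
    rw [sub_eq_add_neg, ← Finset.sum_neg_distrib]
    refine (add_comm _ _).trans ?_
    congr 1 <;> exact Finset.sum_congr rfl fun j _ => by ring
  have hQ : Q ≠ 0 := by
    intro hQ0
    have hP0 : P = 0 := by
      refine eq_zero_of_infinite_isRoot P ?_
      have hinj : Function.Injective fun b : E => algebraMap k A b := fun b b' hbb =>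
        Subtype.ext (FaithfulSMul.algebraMap_injective k A hbb)
      refine (Set.infinite_range_of_injective hinj).mono ?_
      rintro _ ⟨b, rfl⟩
      have := hPQ b
      rw [hQ0, eval_zero, mul_zero] at this
      exact (mul_eq_zero.1 this.symm).resolve_left (hd b)
    apply hc
    funext i
    rcases i with j | j
    · simpa [hP0] using (hPc j).symm
    · simpa [hQ0] using (hQc j).symm
  refine ⟨P, Q, hQ, fun χ b hU => ?_⟩
  -- The chosen `d b` may vanish at `χ`; another fraction for the same slice has a denominator that
  -- does not.
  obtain ⟨n', d', hd', hnd'⟩ := h.fst χ b hU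
  let b' : E := ⟨b, χ, hU⟩
  have huniq : n b' * d' = n' * d b' := h.fst_unique hk hU (hnd b') hnd'
  have hloc : n' * Q.eval (algebraMap k A b) = d' * P.eval (algebraMap k A b) := by
    apply mul_left_cancel₀ (hd b')
    have h1 := hPQ b'
    calc d b' * (n' * Q.eval (algebraMap k A b))
        = (n' * d b') * Q.eval (algebraMap k A b) := by ring
      _ = d' * (n b' * Q.eval (algebraMap k A b)) := by rw [← huniq]; ring
      _ = d b' * (d' * P.eval (algebraMap k A b)) := by rw [h1]; ring
  rw [evalPair_eq_apply_eval, evalPair_eq_apply_eval]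
  apply mul_left_cancel₀ hd'
  rw [← map_mul, ← hloc, map_mul, ← hnd' χ hU]
  ring

/-- Two expressions for a separately regular function that agree generically agree
everywhere. -/
theorem cancel (hk : Cardinal.aleph0 < Cardinal.mk k) (h : SeparatelyRegular U f) {P Q α β : A[X]}
    (hQ : Q ≠ 0) (hPQ : ∀ χ b, (χ, b) ∈ U → evalPair χ b Q * f χ b = evalPair χ b P)
    (hαβ : α * P = β * Q) {χ : A →ₐ[k] k} {b : k} (hU : (χ, b) ∈ U) :
    evalPair χ b α * f χ b = evalPair χ b β := by
  have : Infinite k := IsAlgClosed.instInfinite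
  -- When `Q(b)` is a nonzero element of `A`, the identity can be cancelled inside `A`.
  have hgen : ∀ b χ, Q.eval (algebraMap k A b) ≠ 0 → (χ, b) ∈ U →
      evalPair χ b α * f χ b = evalPair χ b β := by
    intro b χ hQb hU
    obtain ⟨n, d, hd, hnd⟩ := h.fst χ b hU
    have h1 : n * Q.eval (algebraMap k A b) = P.eval (algebraMap k A b) * d := by
      refine h.fst_unique hk hU hnd fun χ' hU' => ?_
      rw [← evalPair_eq_apply_eval, ← evalPair_eq_apply_eval, hPQ χ' b hU']
    have h2 : α.eval (algebraMap k A b) * n = β.eval (algebraMap k A b) * d := by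
      apply mul_right_cancel₀ hQb
      have h3 := congrArg (eval (algebraMap k A b)) hαβ
      rw [eval_mul, eval_mul] at h3
      calc _ = eval (algebraMap k A b) α * (n * Q.eval (algebraMap k A b)) := by ring
        _ = (eval (algebraMap k A b) α * P.eval (algebraMap k A b)) * d := by rw [h1]; ring
        _ = _ := by rw [h3]; ring
    rw [evalPair_eq_apply_eval, evalPair_eq_apply_eval]
    apply mul_right_cancel₀ hd
    rw [← map_mul, ← h2, map_mul, ← hnd χ hU]
    ring
  -- Only finitely many `b` have `Q(b) = 0`. A polynomial identity on the line over `χ` extends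
  -- across them.
  obtain ⟨n, d, hd, hnd⟩ := h.snd χ b hU
  have hbad : {b : k | Q.eval (algebraMap k A b) = 0}.Finite :=
    (finite_setOfPred_isRoot hQ).preimage (FaithfulSMul.algebraMap_injective k A).injOn
  have hpoly : α.map (χ : A →+* k) * n = β.map (χ : A →+* k) * d := by
    refine eq_of_infinite_eval_eq _ _ ((h.infinite_slice hU _ hbad).mono ?_)
    rintro b' ⟨hb', hU'⟩
    have h1 := hgen b' χ hb' hU'
    rw [evalPair_eq_eval_map, evalPair_eq_eval_map] at h1
    simp only [Set.mem_ofPred_eq, eval_mul]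
    rw [← h1, ← hnd b' hU']
    ring
  have h2 := congrArg (eval b) hpoly
  rw [eval_mul, eval_mul, ← evalPair_eq_eval_map, ← evalPair_eq_eval_map, ← hnd b hU] at h2
  apply mul_right_cancel₀ hd
  rw [← h2]
  ring

end SeparatelyRegular

/-! ### Normality excludes poles -/

/-- The denominators of a fraction `P / Q` that lies outside the localization of a Noetherian
integrally closed domain at a prime `m`: for some multiple `h P / Q` they form a prime
ideal `J ≤ m`, and some `r ∈ J` satisfies `r h P / Q ∉ J`. -/
theorem exists_prime_denominators {B : Type*} [CommRing B] [IsDomain B] [IsNoetherianRing B]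
    [IsIntegrallyClosed B] {m : Ideal B} (hm : m.IsPrime) {P Q : B} (hQ : Q ≠ 0)
    (hPQ : ∀ r, Q ∣ r * P → r ∈ m) :
    ∃ J : Ideal B, J.IsPrime ∧ J ≤ m ∧ ∃ h u : B, ∃ r ∈ J, u ∉ J ∧ r * h * P = u * Q := by
  -- The denominator ideal of `h P / Q`; a maximal one among those inside `m` is prime, as for
  -- associated primes.
  let I (h : B) : Ideal B :=
    { carrier := {r | Q ∣ r * h * P}
      add_mem' := fun {a b} ha hb => by
        have := dvd_add ha hb
        simpa only [Set.mem_ofPred_eq, add_mul] using this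
      zero_mem' := by simp
      smul_mem' := fun c x hx => by
        have := Dvd.dvd.mul_left hx c
        simpa only [Set.mem_ofPred_eq, smul_eq_mul, mul_assoc] using this }
  have hI : ∀ h r, r ∈ I h ↔ Q ∣ r * h * P := fun h r => Iff.rfl
  obtain ⟨J, ⟨hJm, h, rfl⟩, hmax⟩ := set_has_maximal_iff_noetherian.2
    (inferInstance : IsNoetherian B B) {J : Ideal B | J ≤ m ∧ ∃ h, J = I h}
    ⟨I 1, fun r hr => hPQ r (by simpa [hI] using hr), 1, rfl⟩
  have hle : ∀ s, I h ≤ I (s * h) := fun s r hr => by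
    rw [hI] at hr ⊢
    have := Dvd.dvd.mul_left hr s
    convert this using 1
    ring
  have hprime : (I h).IsPrime := by
    refine ⟨fun htop => hm.ne_top (top_le_iff.1 (htop ▸ hJm)), fun {x y} hxy => ?_⟩
    by_contra! hcon
    have heq : ∀ s, I (s * h) ≤ m → I (s * h) = I h := fun s hs => by
      by_contra hne
      exact hmax _ ⟨hs, _, rfl⟩ (lt_of_le_of_ne (hle s) (Ne.symm hne))
    have hxy' : x ∈ I (y * h) := by
      rw [hI] at hxy ⊢
      rwa [← mul_assoc x y h]
    -- Maximality forces some `s` outside `m` into `I (y * h)`. Multiplying by `s` does not enlarge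
    -- `I h`, and it puts `y` into `I (s * h)`.
    have hnle : ¬ I (y * h) ≤ m := fun hle' => hcon.1 (heq y hle' ▸ hxy')
    obtain ⟨s, hs, hsm⟩ := Set.not_subset.1 hnle
    have hsm' : I (s * h) ≤ m := fun t ht => by
      have : t * s ∈ m := hJm (by
        rw [hI] at ht ⊢
        rwa [mul_assoc t s h])
      exact (hm.mem_or_mem this).resolve_right hsm
    apply hcon.2
    rw [← heq s hsm', hI]
    have hs' : Q ∣ s * (y * h) * P := hs
    convert hs' using 1
    ring
  refine ⟨I h, hprime, hJm, h, ?_⟩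
  -- Otherwise `g = h P / Q` maps the nonzero finitely generated ideal `I h` into itself, so `g` is
  -- integral, lies in `B`, and `1` is a denominator.
  by_contra! hcon
  let K := FractionRing B
  let g : K := algebraMap B K (h * P) / algebraMap B K Q
  have hQK : algebraMap B K Q ≠ 0 := by simpa using hQ
  let N : Submodule B K := Submodule.map (Algebra.linearMap B K) (I h)
  have hQI : Q ∈ I h := ⟨h * P, by ring⟩
  have hint : IsIntegral B g := by
    refine isIntegral_of_smul_mem_submodule N ?_ ((IsNoetherian.noetherian (I h)).map _) g ?_
    · intro h0
      have : algebraMap B K Q ∈ N := ⟨Q, hQI, rfl⟩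
      rw [h0] at this
      exact hQK ((Submodule.mem_bot B).1 this)
    · rintro _ ⟨r, hr, rfl⟩
      obtain ⟨u, hu⟩ := hr
      have huQ : r * h * P = u * Q := hu.trans (mul_comm _ _)
      refine ⟨u, by_contra fun hu' => hcon u r ⟨u, hu⟩ hu' huQ, ?_⟩
      simp only [Algebra.linearMap_apply, smul_eq_mul, g]
      rw [div_mul_eq_mul_div, eq_div_iff hQK, ← map_mul, ← map_mul, ← huQ]
      congr 1
      ring
  obtain ⟨u, hu⟩ := IsIntegrallyClosed.isIntegral_iff.1 hint
  apply hprime.ne_top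
  rw [Ideal.eq_top_iff_one, hI]
  refine ⟨u, ?_⟩
  apply IsFractionRing.injective B K
  rw [eq_div_iff hQK, ← map_mul] at hu
  rw [one_mul, ← hu, mul_comm]

/-- A separately regular function on an open subset of the product of a normal affine variety and
the affine line is regular. -/
theorem SeparatelyRegular.exists_eq_div [IsAlgClosed k] [IsDomain A] [IsIntegrallyClosed A]
    [Algebra.FiniteType k A] (hk : Cardinal.aleph0 < Cardinal.mk k)
    {U : Set ((A →ₐ[k] k) × k)} {f : (A →ₐ[k] k) → k → k} (h : SeparatelyRegular U f)
    {χ : A →ₐ[k] k} {b : k} (hU : (χ, b) ∈ U) :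
    ∃ n d : A[X], evalPair χ b d ≠ 0 ∧
      ∀ χ' b', (χ', b') ∈ U → evalPair χ' b' d * f χ' b' = evalPair χ' b' n := by
  have : IsNoetherianRing A := Algebra.FiniteType.isNoetherianRing k A
  obtain ⟨P, Q, hQ, hPQ⟩ := h.exists_rational hk ⟨_, hU⟩
  let m : Ideal A[X] := RingHom.ker (evalPair χ b)
  have hm : m.IsPrime := RingHom.ker_isPrime _
  by_cases hden : ∀ r, Q ∣ r * P → r ∈ m
  · obtain ⟨J, hJ, hJm, h', u, r, hr, hu, hru⟩ := exists_prime_denominators hm hQ hden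
    obtain ⟨w, hw, hwU⟩ := h.isOpen χ b hU
    -- The zero locus of `J` passes through the given point, hence meets `U`, even where `u` is
    -- nonzero.
    have hwJ : w ∉ J := fun hwJ => hw (hJm hwJ)
    have huw : u * w ∉ J := fun huw => (hJ.mem_or_mem huw).elim hu hwJ
    obtain ⟨φ, hφ, hφu⟩ := hJ.exists_algHom_ne_zero (k := k) hk huw
    rw [map_mul] at hφu
    have hc := evalPair_comp φ
    have hUφ := hwU (φ.comp CAlgHom) (φ X)
      (by rw [hc]; exact right_ne_zero_of_mul hφu)
    have := h.cancel hk hQ hPQ hru hUφ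
    rw [hc, map_mul, hφ r hr, zero_mul, zero_mul] at this
    exact absurd this.symm (left_ne_zero_of_mul hφu)
  · push Not at hden
    obtain ⟨d, ⟨n, hn⟩, hd⟩ := hden
    exact ⟨n, d, hd, fun χ' b' hU' => h.cancel hk hQ hPQ (hn.trans (mul_comm _ _)) hU'⟩

end SeparatelyRegular

/-! ### Affine charts of a variety -/

namespace FunctionSheaf

variable {k : Type*} [Field k] {X Y : Type*}

theorem RegularAt.congr {S : FunctionSheaf k X} {g g' : X → k} {x : X} (hg : S.RegularAt g x)
    (h : ∀ᶠ y in @nhds X S.toTopologicalSpace x, g' y = g y) : S.RegularAt g' x := by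
  have : (g' : Germ (@nhds X S.toTopologicalSpace x) k) = g := Germ.coe_eq.2 h
  unfold RegularAt
  rwa [this]

/-- An algebra is closed under products, so its nonvanishing loci form a basis and not merely a
subbasis. -/
theorem exists_ne_zero_subset_of_isOpen {R : Subalgebra k (Y → k)} {O : Set Y}
    (hO : IsOpen[algebraTopology R] O) {y : Y} (hy : y ∈ O) :
    ∃ d ∈ R, d y ≠ 0 ∧ ∀ z, d z ≠ 0 → z ∈ O := by
  change TopologicalSpace.GenerateOpen _ O at hO
  induction hO with
  | basic O hO =>
    obtain ⟨d, hd, rfl⟩ := hO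
    exact ⟨d, hd, hy, fun z hz => hz⟩
  | univ => exact ⟨1, R.one_mem, one_ne_zero, fun _ _ => trivial⟩
  | inter O O' _ _ ih ih' =>
    obtain ⟨d, hd, hdy, h⟩ := ih hy.1
    obtain ⟨d', hd', hdy', h'⟩ := ih' hy.2
    exact ⟨d * d', R.mul_mem hd hd', mul_ne_zero hdy hdy', fun z hz =>
      ⟨h z (left_ne_zero_of_mul hz), h' z (right_ne_zero_of_mul hz)⟩⟩
  | sUnion s _ ih =>
    obtain ⟨O, hO, hyO⟩ := hy
    obtain ⟨d, hd, hdy, h⟩ := ih O hO hyO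
    exact ⟨d, hd, hdy, fun z hz => ⟨O, hO, h z hz⟩⟩

theorem isOpen_ne_zero {R : Subalgebra k (Y → k)} {d : Y → k} (hd : d ∈ R) :
    IsOpen[algebraTopology R] {y | d y ≠ 0} :=
  TopologicalSpace.isOpen_generateFrom_of_mem ⟨d, hd, rfl⟩

/-- Multiplying numerator and denominator by a function supported in the neighbourhood makes both
sides vanish elsewhere, so a statement about germs becomes a global identity. -/
theorem regularAt_ofAlgebra_iff {R : Subalgebra k (Y → k)} {g : Y → k} {y : Y} :
    (ofAlgebra R).RegularAt g y ↔
      ∃ n ∈ R, ∃ d ∈ R, d y ≠ 0 ∧ ∀ z, d z * g z = n z := by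
  let := algebraTopology R
  constructor
  · rintro ⟨n, hn, d, hd, hdy, h⟩
    obtain ⟨O, hO, hOo, hyO⟩ := eventually_nhds_iff.1 (Germ.coe_eq.1 h)
    obtain ⟨s, hs, hsy, hsO⟩ := exists_ne_zero_subset_of_isOpen hOo hyO
    refine ⟨n * (s * d), R.mul_mem hn (R.mul_mem hs hd), d * (s * d),
      R.mul_mem hd (R.mul_mem hs hd), mul_ne_zero hdy (mul_ne_zero hsy hdy), fun z => ?_⟩
    simp only [Pi.mul_apply]
    by_cases hz : s z * d z = 0
    · simp [hz]
    · rw [hO z (hsO z (left_ne_zero_of_mul hz))]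
      have := right_ne_zero_of_mul hz
      field_simp
  · rintro ⟨n, hn, d, hd, hdy, h⟩
    refine ⟨n, hn, d, hd, hdy, Germ.coe_eq.2 ?_⟩
    filter_upwards [(isOpen_ne_zero hd).mem_nhds hdy] with z hz
    rw [← h z, mul_div_cancel_left₀ _ hz]

/-- Evaluation at a point as a homomorphism on an algebra of functions. -/
def pointEval (A : Subalgebra k (Y → k)) (y : Y) : A →ₐ[k] k :=
  (Pi.evalAlgHom k (fun _ => k) y).comp A.val

@[simp] theorem pointEval_apply (A : Subalgebra k (Y → k)) (y : Y) (a : A) :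
    pointEval A y a = a.1 y := rfl

/-- An open subset `V` of `X` that is an affine variety with coordinate ring `A`. -/
structure IsAffineChart (S : FunctionSheaf k X) (V : Set X) (A : Subalgebra k (V → k)) : Prop where
  isOpen : IsOpen[S.toTopologicalSpace] V
  fg : A.FG
  bijective : Function.Bijective (pointEval A)
  isOpen_ne_zero : ∀ s ∈ A, IsOpen[S.toTopologicalSpace] (Subtype.val '' {x | s x ≠ 0})
  exists_ne_zero_subset : ∀ W, IsOpen[S.toTopologicalSpace] W → ∀ x : V, x.1 ∈ W →
    ∃ s ∈ A, s x ≠ 0 ∧ ∀ y : V, s y ≠ 0 → y.1 ∈ W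
  regularAt_iff : ∀ (g : X → k) (x : V), S.RegularAt g x ↔
    ∃ n ∈ A, ∃ d ∈ A, d x ≠ 0 ∧ ∀ y : V, d y * g y = n y

/-- A locally closed subset of an affine variety is covered by affine charts. -/
theorem exists_isAffineChart_of_isLocallyClosed {S : FunctionSheaf k X} {R : Subalgebra k (Y → k)}
    (hR : R.FG) (hbij : Function.Bijective (pointEval R)) {V₀ : Set X}
    (hV₀ : IsOpen[S.toTopologicalSpace] V₀) {U : Set Y}
    (hU : @IsLocallyClosed _ (algebraTopology R) U) (e : V₀ ≃ U)
    (he : IsMorphism (S.restrict V₀) ((ofAlgebra R).restrict U) e)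
    (he' : IsMorphism ((ofAlgebra R).restrict U) (S.restrict V₀) e.symm) (x₀ : V₀) :
    ∃ (V : Set X) (A : Subalgebra k (V → k)), S.IsAffineChart V A ∧ x₀.1 ∈ V := by
  let := S.toTopologicalSpace
  let := algebraTopology R
  obtain ⟨O, C, hO, hC, rfl⟩ := hU
  obtain ⟨t, rfl⟩ := hR
  set R := Algebra.adjoin k (t : Set (Y → k)) with hRdef
  -- Inside `{h ≠ 0}` the openness condition `O` holds automatically, so the chart is closed in a
  -- principal open set.
  obtain ⟨h, hhR, hhx, hhO⟩ := exists_ne_zero_subset_of_isOpen hO (e x₀).2.1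
  let V : Set X := {x | ∃ hx : x ∈ V₀, h (e ⟨x, hx⟩) ≠ 0}
  let i (x : V) : V₀ := ⟨x.1, x.2.1⟩
  let c (x : V) : Y := e (i x)
  have hhc : ∀ x : V, h (c x) ≠ 0 := fun x => x.2.2
  have hinj : Function.Injective c := fun x y hxy =>
    Subtype.ext (congrArg (fun z : V₀ => z.1) (e.injective (Subtype.ext hxy)))
  let A : Subalgebra k (V → k) :=
    Algebra.adjoin k ((fun p : Y → k => p ∘ c) '' (t : Set (Y → k)) ∪ {fun x => (h (c x))⁻¹})
  have hpull : ∀ p ∈ R, p ∘ c ∈ A := by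
    intro p hp
    induction hp using Algebra.adjoin_induction with
    | mem p hp => exact Algebra.subset_adjoin (Or.inl ⟨p, hp, rfl⟩)
    | algebraMap r => exact A.algebraMap_mem r
    | add p q _ _ hp hq => exact A.add_mem hp hq
    | mul p q _ _ hp hq => exact A.mul_mem hp hq
  have hfrac : ∀ a ∈ A, ∃ N : ℕ, ∃ p ∈ R, ∀ x, a x * h (c x) ^ N = p (c x) := by
    intro a ha
    induction ha using Algebra.adjoin_induction with
    | mem a ha =>
      rcases ha with ⟨p, hp, rfl⟩ | rfl
      · exact ⟨0, p, Algebra.subset_adjoin hp, fun x => by simp⟩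
      · exact ⟨1, 1, R.one_mem, fun x => by simp [hhc x]⟩
    | algebraMap r => exact ⟨0, algebraMap k _ r, R.algebraMap_mem r, fun x => by simp⟩
    | add a b _ _ ha hb =>
      obtain ⟨N, p, hp, hap⟩ := ha
      obtain ⟨M, q, hq, hbq⟩ := hb
      refine ⟨N + M, p * h ^ M + q * h ^ N, R.add_mem (R.mul_mem hp (R.pow_mem hhR _))
        (R.mul_mem hq (R.pow_mem hhR _)), fun x => ?_⟩
      simp only [Pi.add_apply, Pi.mul_apply, Pi.pow_apply, ← hap, ← hbq]
      ring
    | mul a b _ _ ha hb =>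
      obtain ⟨N, p, hp, hap⟩ := ha
      obtain ⟨M, q, hq, hbq⟩ := hb
      refine ⟨N + M, p * q, R.mul_mem hp hq, fun x => ?_⟩
      simp only [Pi.mul_apply, ← hap, ← hbq]
      ring
  have hopen : ∀ O : Set Y, IsOpen O → IsOpen (Subtype.val '' {x : V | c x ∈ O}) := by
    intro O' hO'
    have hcont : Continuous fun x : V₀ => (e x : Y) := continuous_subtype_val.comp he.1
    obtain ⟨W, hW, hWO⟩ := isOpen_induced_iff.1
      (hcont.isOpen_preimage _ (hO'.inter (isOpen_ne_zero hhR)))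
    convert hW.inter hV₀ using 1
    ext x
    constructor
    · rintro ⟨x, hx, rfl⟩
      have : i x ∈ Subtype.val ⁻¹' W := by
        rw [hWO]
        exact ⟨hx, hhc x⟩
      exact ⟨this, (i x).2⟩
    · rintro ⟨hx, hx0⟩
      have : (⟨x, hx0⟩ : V₀) ∈ Subtype.val ⁻¹' W := hx
      rw [hWO] at this
      exact ⟨⟨x, hx0, this.2⟩, this.1, rfl⟩
  have hVopen : IsOpen V := by
    convert hopen Set.univ isOpen_univ using 1
    ext x
    simp
  have hDopen : ∀ s ∈ A, IsOpen (Subtype.val '' {x | s x ≠ 0}) := by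
    intro s hs
    obtain ⟨N, p, hp, hsp⟩ := hfrac s hs
    convert hopen _ (isOpen_ne_zero hp) using 2
    ext x
    simp [← hsp, hhc x]
  refine ⟨V, A, ⟨hVopen, ?_, ⟨?_, ?_⟩, hDopen, ?_, ?_⟩, ⟨x₀.2, hhx⟩⟩
  · exact Subalgebra.fg_def.2 ⟨_, (t.finite_toSet.image _).union (Set.finite_singleton _), rfl⟩
  · intro x y hxy
    apply hinj
    apply hbij.1
    ext ⟨p, hp⟩
    exact DFunLike.congr_fun hxy ⟨p ∘ c, hpull p hp⟩
  · intro χ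
    let ρ : R →ₐ[k] A :=
      { toFun := fun p => ⟨p.1 ∘ c, hpull p p.2⟩
        map_one' := rfl
        map_mul' := fun _ _ => rfl
        map_zero' := rfl
        map_add' := fun _ _ => rfl
        commutes' := fun _ => rfl }
    obtain ⟨y, hy⟩ := hbij.2 (χ.comp ρ)
    have hy' : ∀ p (hp : p ∈ R), p y = χ ⟨p ∘ c, hpull p hp⟩ := fun p hp =>
      DFunLike.congr_fun hy ⟨p, hp⟩
    -- The point `y` lies in the chart: `h` is a unit of `A`, and functions vanishing on `C` pull
    -- back to zero in `A`.
    have hhy : h y ≠ 0 := by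
      intro h0
      have hunit : (⟨h ∘ c, hpull h hhR⟩ : A) *
          ⟨fun x => (h (c x))⁻¹, Algebra.subset_adjoin (Or.inr rfl)⟩ = 1 := by
        ext x
        exact mul_inv_cancel₀ (hhc x)
      have := congrArg χ hunit
      rw [map_mul, ← hy' h hhR, h0, zero_mul, map_one] at this
      exact zero_ne_one this
    have hyC : y ∈ C := by
      by_contra hyC
      obtain ⟨s, hs, hsy, hsC⟩ := exists_ne_zero_subset_of_isOpen hC.isOpen_compl hyC
      apply hsy
      have h0 : (⟨s ∘ c, hpull s hs⟩ : A) = 0 := by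
        ext x
        by_contra hne
        exact hsC _ hne (e (i x)).2.2
      rw [hy' s hs, h0, map_zero]
    let u : ↥(O ∩ C) := ⟨y, hhO y hhy, hyC⟩
    let x : V := ⟨e.symm u, (e.symm u).2, by simpa [u] using hhy⟩
    have hcx : c x = y := by simp [c, i, x, u]
    refine ⟨x, ?_⟩
    ext ⟨a, ha⟩
    obtain ⟨N, p, hp, hap⟩ := hfrac a ha
    have h1 : (⟨a, ha⟩ : A) * ⟨h ∘ c, hpull h hhR⟩ ^ N = ⟨p ∘ c, hpull p hp⟩ := by
      ext x
      exact hap x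
    have h2 := congrArg χ h1
    rw [map_mul, map_pow, ← hy' h hhR, ← hy' p hp] at h2
    have h3 := hap x
    rw [hcx, ← h2] at h3
    exact mul_right_cancel₀ (pow_ne_zero N hhy) h3
  · intro W hW x hx
    obtain ⟨O', hO', hOW⟩ := isOpen_induced_iff.1
      ((continuous_subtype_val.comp he'.1 :
        Continuous fun u : ↥(O ∩ C) => (e.symm u : X)).isOpen_preimage W hW)
    have hmem : ∀ y : V, c y ∈ O' ↔ y.1 ∈ W := fun y => by
      have : e (i y) ∈ Subtype.val ⁻¹' O' ↔ y.1 ∈ W := by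
        rw [hOW]
        simp [i]
      exact this
    obtain ⟨p, hp, hpx, hpO⟩ := exists_ne_zero_subset_of_isOpen hO' ((hmem x).2 hx)
    exact ⟨p ∘ c, hpull p hp, hpx, fun y hy => (hmem y).1 (hpO _ hy)⟩
  · intro g x
    constructor
    · intro hg
      have h1 : (S.restrict V₀).RegularAt (fun y => g y) (i x) := ⟨g, hg, rfl⟩
      obtain ⟨F, hF, hgF⟩ := he'.2 (e (i x)) (fun y => g y) (by rwa [e.symm_apply_apply])
      obtain ⟨n, hn, d, hd, hdx, hnd⟩ := regularAt_ofAlgebra_iff.1 hF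
      have h2 : ∀ᶠ u : ↥(O ∩ C) in 𝓝 (e (i x)), g (e.symm u) = F u := Germ.coe_eq.1 hgF
      rw [nhds_induced, eventually_comap] at h2
      obtain ⟨O', hO', hOo, hxO⟩ := eventually_nhds_iff.1 h2
      obtain ⟨s, hs, hsx, hsO⟩ := exists_ne_zero_subset_of_isOpen hOo hxO
      refine ⟨(n * s) ∘ c, hpull _ (R.mul_mem hn hs), (d * s) ∘ c, hpull _ (R.mul_mem hd hs),
        mul_ne_zero hdx hsx, fun y => ?_⟩
      simp only [Function.comp_apply, Pi.mul_apply]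
      by_cases hsy : s (c y) = 0
      · simp [hsy]
      · have h3 := hO' (c y) (hsO _ hsy) (e (i y)) rfl
        rw [e.symm_apply_apply] at h3
        have h4 : g y = F (c y) := h3
        rw [h4, ← hnd (c y)]
        ring
    · rintro ⟨n, hn, d, hd, hdx, hnd⟩
      obtain ⟨N, p, hp, hnp⟩ := hfrac n hn
      obtain ⟨M, q, hq, hdq⟩ := hfrac d hd
      -- This is `n / d` rewritten on the ambient space, with the powers of `h` from `hfrac`
      -- cleared.
      let F : Y → k := fun y => (p y * h y ^ M) / (q y * h y ^ N)
      have hgF : ∀ y : V, d y ≠ 0 → g y = F (c y) := by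
        intro y hy
        have hhy := hhc y
        simp only [F, ← hnp, ← hdq, ← hnd]
        field_simp
      have hF : (ofAlgebra R).RegularAt F (c x) := by
        refine ⟨p * h ^ M, R.mul_mem hp (R.pow_mem hhR _), q * h ^ N,
          R.mul_mem hq (R.pow_mem hhR _), ?_, rfl⟩
        simp only [Pi.mul_apply, Pi.pow_apply, ← hdq]
        exact mul_ne_zero (mul_ne_zero hdx (pow_ne_zero _ (hhc x))) (pow_ne_zero _ (hhc x))
      obtain ⟨G, hG, hFG⟩ := he.2 (i x) (fun u => F u) ⟨F, hF, rfl⟩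
      have h2 : ∀ᶠ y : V₀ in 𝓝 (i x), F (e y) = G y := Germ.coe_eq.1 hFG
      rw [nhds_induced, eventually_comap] at h2
      refine RegularAt.congr hG ?_
      filter_upwards [h2, (hDopen d hd).mem_nhds ⟨x, hdx, rfl⟩] with y hy hy'
      obtain ⟨y, hdy, rfl⟩ := hy'
      rw [hgF y hdy]
      exact hy (i y) rfl

theorem fg_polynomialFunctions (k : Type*) [Field k] (n : ℕ) :
    (MvPolynomial.aeval (R := k) fun (i : Fin n) (x : Fin n → k) => x i).range.FG := by
  rw [← Algebra.adjoin_range_eq_range_aeval]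
  exact Subalgebra.fg_def.2 ⟨_, Set.finite_range _, rfl⟩

/-- A character is evaluation at the point whose coordinates are its values on the coordinate
functions. -/
theorem bijective_pointEval_polynomialFunctions (k : Type*) [Field k] (n : ℕ) :
    Function.Bijective
      (pointEval (MvPolynomial.aeval (R := k) fun (i : Fin n) (x : Fin n → k) => x i).range) := by
  let ξ : Fin n → (Fin n → k) → k := fun i x => x i
  let X' (i : Fin n) : (MvPolynomial.aeval (R := k) ξ).range :=
    ⟨ξ i, MvPolynomial.X i, MvPolynomial.aeval_X ξ i⟩
  constructor
  · intro x y hxy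
    funext i
    exact DFunLike.congr_fun hxy (X' i)
  · intro χ
    refine ⟨fun i => χ (X' i), ?_⟩
    have h : ∀ φ ψ : (MvPolynomial.aeval (R := k) ξ).range →ₐ[k] k, (∀ i, φ (X' i) = ψ (X' i)) →
        φ = ψ := by
      intro φ ψ hφψ
      have hcomp : φ.comp (MvPolynomial.aeval (R := k) ξ).rangeRestrict =
          ψ.comp (MvPolynomial.aeval (R := k) ξ).rangeRestrict := by
        ext i
        have : (MvPolynomial.aeval (R := k) ξ).rangeRestrict (MvPolynomial.X i) = X' i :=
          Subtype.ext (MvPolynomial.aeval_X ξ i)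
        simpa [this] using hφψ i
      ext a
      obtain ⟨p, rfl⟩ := (MvPolynomial.aeval (R := k) ξ).rangeRestrict_surjective a
      exact DFunLike.congr_fun hcomp p
    exact h _ _ fun i => rfl

theorem IsVariety.exists_isAffineChart {S : FunctionSheaf k X} (hX : S.IsVariety) (x : X) :
    ∃ (V : Set X) (A : Subalgebra k (V → k)), S.IsAffineChart V A ∧ x ∈ V := by
  obtain ⟨m, V, hVo, hcover, hch⟩ := hX.exists_charts
  obtain ⟨i, hi⟩ := Set.mem_iUnion.1 (hcover.symm ▸ Set.mem_univ x : x ∈ ⋃ i, V i)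
  obtain ⟨n, U, hU, e, he, he'⟩ := hch i
  exact exists_isAffineChart_of_isLocallyClosed (fg_polynomialFunctions k n)
    (bijective_pointEval_polynomialFunctions k n) (hVo i) hU e he he' ⟨x, hi⟩

end FunctionSheaf

/-! ### Coordinate rings of charts of a normal variety -/

/-- An element of the fraction field of `A` that is integral over `A` lies in every integrally
closed domain containing `A`. -/
theorem exists_mul_eq_of_isIntegral {A O : Type*} [CommRing A] [IsDomain A] [CommRing O] [IsDomain O]
    [IsIntegrallyClosed O] (ι : A →+* O) (hι : Function.Injective ι) {n d : A} (hd : d ≠ 0)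
    (hint : IsIntegral A
      (algebraMap A (FractionRing A) n / algebraMap A (FractionRing A) d)) :
    ∃ γ : O, γ * ι d = ι n := by
  let j : A →+* FractionRing O := (algebraMap O (FractionRing O)).comp ι
  have hj : Function.Injective j := (IsFractionRing.injective O (FractionRing O)).comp hι
  let J : FractionRing A →+* FractionRing O := IsFractionRing.lift hj
  have hJ : ∀ a, J (algebraMap A (FractionRing A) a) = j a :=
    fun a => IsFractionRing.lift_algebraMap hj a
  have hint' : IsIntegral O
      (J (algebraMap A (FractionRing A) n / algebraMap A (FractionRing A) d)) := by
    obtain ⟨p, hp, hp0⟩ := hint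
    refine ⟨p.map ι, hp.map ι, ?_⟩
    have := congrArg J hp0
    rw [Polynomial.hom_eval₂, map_zero] at this
    have hcomp : (algebraMap O (FractionRing O)).comp ι = J.comp (algebraMap A (FractionRing A)) :=
      RingHom.ext fun a => (hJ a).symm
    rw [Polynomial.eval₂_map, hcomp]
    exact this
  obtain ⟨γ, hγ⟩ := IsIntegrallyClosed.isIntegral_iff.1 hint'
  rw [map_div₀, hJ, hJ, eq_div_iff ((map_ne_zero_iff j hj).2 hd)] at hγ
  exact ⟨γ, IsFractionRing.injective O (FractionRing O) (by rw [map_mul]; exact hγ)⟩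

/-- Being integrally closed can be checked at the points of an affine variety. -/
theorem isIntegrallyClosed_of_forall_algHom {k A : Type*} [Field k] [IsAlgClosed k]
    (hk : Cardinal.aleph0 < Cardinal.mk k) [CommRing A] [IsDomain A] [Algebra k A]
    [Algebra.FiniteType k A]
    (h : ∀ (χ : A →ₐ[k] k) (n d : A), d ≠ 0 →
      IsIntegral A (algebraMap A (FractionRing A) n / algebraMap A (FractionRing A) d) →
      ∃ r, χ r ≠ 0 ∧ d ∣ r * n) : IsIntegrallyClosed A := by
  rw [isIntegrallyClosed_iff (FractionRing A)]
  intro z hz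
  obtain ⟨n, d, hd, rfl⟩ := IsFractionRing.div_surjective (A := A) z
  have hd0 : d ≠ 0 := nonZeroDivisors.ne_zero hd
  -- The denominators of `n / d`: by hypothesis they do not all vanish at any point, so they
  -- generate the unit ideal.
  let I : Ideal A := (Ideal.span {d}).colon {n}
  have hI : ∀ r, r ∈ I ↔ d ∣ r * n := fun r => by
    simp [I, Submodule.mem_colon_singleton, Ideal.mem_span_singleton]
  have htop : I = ⊤ := by
    by_contra hne
    obtain ⟨m, hm, hIm⟩ := Ideal.exists_le_maximal I hne
    obtain ⟨φ, hφ, -⟩ := hm.isPrime.exists_algHom_ne_zero (k := k) hk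
      (fun h1 => hm.ne_top ((Ideal.eq_top_iff_one m).2 h1))
    obtain ⟨r, hr, hrn⟩ := h φ n d hd0 hz
    exact hr (hφ r (hIm ((hI r).2 hrn)))
  obtain ⟨y, hy⟩ := (hI 1).1 (htop ▸ Submodule.mem_top)
  refine ⟨y, ?_⟩
  rw [eq_div_iff (by simpa using hd0), ← map_mul, mul_comm, ← hy, one_mul]

namespace FunctionSheaf

open Polynomial

variable {k : Type*} [Field k] {X Y : Type*}

namespace IsAffineChart

variable {S : FunctionSheaf k X} {V : Set X} {A : Subalgebra k (V → k)}

/-- Nonzero functions have nonempty open nonvanishing loci, which meet by irreducibility. -/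
theorem isDomain (hA : S.IsAffineChart V A) (hX : @IrreducibleSpace X S.toTopologicalSpace)
    (hV : V.Nonempty) : IsDomain A := by
  let := S.toTopologicalSpace
  have : Nontrivial A := by
    obtain ⟨x, hx⟩ := hV
    exact (pointEval A ⟨x, hx⟩).toRingHom.domain_nontrivial
  have : NoZeroDivisors A := by
    refine ⟨fun {a b} hab => ?_⟩
    by_contra! hne
    have hnon : ∀ s : A, s ≠ 0 → (Subtype.val '' {x | s.1 x ≠ 0}).Nonempty := by
      intro s hs
      by_contra hemp
      apply hs
      ext x
      by_contra hx
      exact hemp ⟨x, x, hx, rfl⟩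
    obtain ⟨_, ⟨x, hx, rfl⟩, ⟨y, hy, hyx⟩⟩ := nonempty_preirreducible_inter
      (hA.isOpen_ne_zero a a.2) (hA.isOpen_ne_zero b b.2) (hnon a hne.1) (hnon b hne.2)
    obtain rfl : y = x := Subtype.ext hyx
    exact mul_ne_zero hx hy (congrFun (congrArg Subtype.val hab) y)
  exact NoZeroDivisors.to_isDomain A

theorem finiteType (hA : S.IsAffineChart V A) : Algebra.FiniteType k A :=
  A.fg_iff_finiteType.1 hA.fg

/-- Extension by zero of functions on a subset. -/
noncomputable def extendZero (a : V → k) : X → k := Function.extend Subtype.val a 0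

@[simp] theorem extendZero_coe (a : V → k) (x : V) : extendZero a x = a x :=
  Subtype.val_injective.extend_apply _ _ _

theorem regularAt_extendZero (hA : S.IsAffineChart V A) {a : V → k} (ha : a ∈ A) (x : V) :
    S.RegularAt (extendZero a) x :=
  (hA.regularAt_iff _ x).2 ⟨a, ha, 1, A.one_mem, one_ne_zero, fun y => by simp⟩

theorem mem_nhds (hA : S.IsAffineChart V A) (x : V) : V ∈ @nhds X S.toTopologicalSpace x := by
  let := S.toTopologicalSpace
  exact hA.isOpen.mem_nhds x.2

/-- The homomorphism from the coordinate ring of a chart to the local ring at a point. -/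
noncomputable def toStalk (hA : S.IsAffineChart V A) (x : V) : A →+* S.stalk x where
  toFun a := ⟨(extendZero a.1 : X → k), hA.regularAt_extendZero a.2 x⟩
  map_one' := Subtype.ext <| Germ.coe_eq.2 <| by
    filter_upwards [mem_nhds hA x] with y hy
    exact extendZero_coe (1 : V → k) ⟨y, hy⟩
  map_mul' a b := Subtype.ext <| Germ.coe_eq.2 <| by
    filter_upwards [mem_nhds hA x] with y hy
    have h (a : V → k) : extendZero a y = a ⟨y, hy⟩ := extendZero_coe a ⟨y, hy⟩
    simp [h]
  map_zero' := Subtype.ext <| Germ.coe_eq.2 <| by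
    filter_upwards [mem_nhds hA x] with y hy
    exact extendZero_coe (0 : V → k) ⟨y, hy⟩
  map_add' a b := Subtype.ext <| Germ.coe_eq.2 <| by
    filter_upwards [mem_nhds hA x] with y hy
    have h (a : V → k) : extendZero a y = a ⟨y, hy⟩ := extendZero_coe a ⟨y, hy⟩
    simp [h]

theorem toStalk_injective (hA : S.IsAffineChart V A)
    (hX : @IrreducibleSpace X S.toTopologicalSpace) (x : V) :
    Function.Injective (hA.toStalk x) := by
  let := S.toTopologicalSpace
  have := hA.isDomain hX ⟨x, x.2⟩
  rw [injective_iff_map_eq_zero]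
  intro a ha
  have h : ∀ᶠ y in 𝓝 (x : X), extendZero a.1 y = 0 := Germ.coe_eq.1 (congrArg Subtype.val ha)
  obtain ⟨W, hW, hWo, hxW⟩ := eventually_nhds_iff.1 h
  obtain ⟨s, hs, hsx, hsW⟩ := hA.exists_ne_zero_subset W hWo x hxW
  have hmul : a * ⟨s, hs⟩ = 0 := by
    ext y
    change a.1 y * s y = 0
    by_cases hsy : s y = 0
    · rw [hsy, mul_zero]
    · have := hW y (hsW y hsy)
      rw [extendZero_coe] at this
      rw [this, zero_mul]
  refine (mul_eq_zero.1 hmul).resolve_right fun h0 => hsx ?_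
  exact congrFun (congrArg Subtype.val h0) x

/-- An integral fraction is a germ in each local ring, and a germ is a fraction of `A` with
denominator nonzero at the point. -/
theorem isIntegrallyClosed [IsAlgClosed k] (hk : Cardinal.aleph0 < Cardinal.mk k)
    (hA : S.IsAffineChart V A) (hX : @IrreducibleSpace X S.toTopologicalSpace) (hN : S.IsNormal)
    [IsDomain A] : IsIntegrallyClosed A := by
  have := hA.finiteType
  refine isIntegrallyClosed_of_forall_algHom (k := k) hk fun χ n d hd hint => ?_
  obtain ⟨x, rfl⟩ := hA.bijective.2 χ
  obtain ⟨h1, h2⟩ := hN x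
  have hι := hA.toStalk_injective hX x
  obtain ⟨⟨γ, hγ⟩, hγd⟩ := exists_mul_eq_of_isIntegral (hA.toStalk x) hι hd hint
  induction γ using Germ.inductionOn with
  | h g =>
    obtain ⟨n', hn', d', hd', hdx', hnd⟩ := (hA.regularAt_iff g x).1 hγ
    have hg : hA.toStalk x ⟨d', hd'⟩ * ⟨(g : Germ _ k), hγ⟩ = hA.toStalk x ⟨n', hn'⟩ := by
      refine Subtype.ext (Germ.coe_eq.2 ?_)
      filter_upwards [mem_nhds hA x] with y hy
      have h (a : V → k) : extendZero a y = a ⟨y, hy⟩ := extendZero_coe a ⟨y, hy⟩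
      simpa [h] using hnd ⟨y, hy⟩
    refine ⟨⟨d', hd'⟩, hdx', ⟨n', hn'⟩, hι ?_⟩
    rw [map_mul, map_mul, ← hγd, ← hg]
    ring

end IsAffineChart

end FunctionSheaf

/-! ### The product with the affine line -/

namespace FunctionSheaf

open Polynomial

variable {k : Type*} [Field k] {X Y : Type*}

theorem mem_range_aeval_id_iff {g : k → k} :
    g ∈ (aeval (R := k) (id : k → k)).range ↔ ∃ p : k[X], ∀ b, g b = p.eval b := by
  have h : ∀ (p : k[X]) (b : k), aeval (id : k → k) p b = p.eval b := fun p b => by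
    change Pi.evalAlgHom k (fun _ => k) b (aeval id p) = _
    rw [← aeval_algHom_apply]
    simp
  constructor
  · rintro ⟨p, rfl⟩
    exact ⟨p, h p⟩
  · rintro ⟨p, hp⟩
    exact ⟨p, funext fun b => (h p b).trans (hp b).symm⟩

theorem regularAt_affineLine_iff {g : k → k} {b : k} :
    (affineLine k).RegularAt g b ↔
      ∃ n d : k[X], d.eval b ≠ 0 ∧ ∀ b', d.eval b' * g b' = n.eval b' := by
  unfold affineLine
  rw [regularAt_ofAlgebra_iff]
  constructor
  · rintro ⟨n, hn, d, hd, hdb, h⟩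
    obtain ⟨p, hp⟩ := mem_range_aeval_id_iff.1 hn
    obtain ⟨q, hq⟩ := mem_range_aeval_id_iff.1 hd
    exact ⟨p, q, by rwa [← hq], fun b' => by rw [← hp, ← hq, h]⟩
  · rintro ⟨p, q, hq, h⟩
    exact ⟨fun b => p.eval b, mem_range_aeval_id_iff.2 ⟨p, fun _ => rfl⟩, fun b => q.eval b,
      mem_range_aeval_id_iff.2 ⟨q, fun _ => rfl⟩, hq, h⟩

theorem regularAt_affineLine_id (b : k) : (affineLine k).RegularAt id b :=
  regularAt_affineLine_iff.2 ⟨Polynomial.X, 1, by simp, fun b => by simp⟩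

theorem exists_eval_ne_zero_subset {O : Set k} (hO : IsOpen[(affineLine k).toTopologicalSpace] O)
    {b : k} (hb : b ∈ O) : ∃ q : k[X], q.eval b ≠ 0 ∧ ∀ b', q.eval b' ≠ 0 → b' ∈ O := by
  obtain ⟨d, hd, hdb, h⟩ := exists_ne_zero_subset_of_isOpen hO hb
  obtain ⟨q, hq⟩ := mem_range_aeval_id_iff.1 hd
  exact ⟨q, by rwa [← hq], fun b' hb' => h b' (by rwa [hq])⟩

/-- The total function that extends a partial function by zero. -/
noncomputable def totalize (f : X →. k) (x : X) : k :=
  open Classical in (f x).getOrElse 0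

theorem totalize_coe (f : X →. k) (x : f.Dom) : totalize f x = f.asSubtype x := by
  classical
  exact Part.getOrElse_of_dom _ x.2 _

/-- The coordinate `id` of the line is pulled back, and germs on the open domain are germs on `X`.
-/
theorem IsRationalFunction.regularAt {S : FunctionSheaf k X} {f : X →. k}
    (hf : S.IsRationalFunction f) {x : X} (hx : x ∈ f.Dom) : S.RegularAt (totalize f) x := by
  let := S.toTopologicalSpace
  obtain ⟨hopen, -, hmor⟩ := hf
  obtain ⟨G, hG, hfG⟩ := hmor.2 ⟨x, hx⟩ id (regularAt_affineLine_id _)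
  have h : ∀ᶠ y : f.Dom in 𝓝 ⟨x, hx⟩, f.asSubtype y = G y := Germ.coe_eq.1 hfG
  rw [nhds_induced, eventually_comap] at h
  refine hG.congr ?_
  filter_upwards [h, hopen.mem_nhds hx] with y hy hyd
  rw [← hy ⟨y, hyd⟩ rfl]
  exact totalize_coe f ⟨y, hyd⟩

section Prod

variable {S : FunctionSheaf k X} {T : FunctionSheaf k Y}

theorem regularAt_prod_iff {g : X × Y → k} {p : X × Y} :
    (S.prod T).RegularAt g p ↔ ∃ n ∈ S.tensorOn T {p.1} {p.2}, ∃ d ∈ S.tensorOn T {p.1} {p.2},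
      d p ≠ 0 ∧ ∀ᶠ q in @nhds _ (S.prodTopology T) p, g q = n q / d q := by
  constructor
  · rintro ⟨n, hn, d, hd, hdp, h⟩
    exact ⟨n, hn, d, hd, hdp, Germ.coe_eq.1 h⟩
  · rintro ⟨n, hn, d, hd, hdp, h⟩
    exact ⟨n, hn, d, hd, hdp, Germ.coe_eq.2 h⟩

theorem eventually_ne_zero_of_mem_tensorOn {p : X × Y} {F : X × Y → k}
    (hF : F ∈ S.tensorOn T {p.1} {p.2}) (hp : F p ≠ 0) :
    ∀ᶠ q in @nhds _ (S.prodTopology T) p, F q ≠ 0 := by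
  obtain ⟨V, W, hV, hW, hpV, hpW, h⟩ := exists_mem_tensorOn S T p hF
  filter_upwards [eventually_prodTopology S T p hV hW h hpV hpW hp] with q hq using hq.2.2

theorem RegularAt.eventually_ne_zero {g : X × Y → k} {p : X × Y} (hg : (S.prod T).RegularAt g p)
    (hp : g p ≠ 0) : ∀ᶠ q in @nhds _ (S.prodTopology T) p, g q ≠ 0 := by
  let := S.prodTopology T
  obtain ⟨n, hn, d, hd, hdp, h⟩ := regularAt_prod_iff.1 hg
  have hnp : n p ≠ 0 := by
    intro h0
    rw [h.self_of_nhds, h0, zero_div] at hp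
    exact hp rfl
  filter_upwards [h, eventually_ne_zero_of_mem_tensorOn hn hnp,
    eventually_ne_zero_of_mem_tensorOn hd hdp] with q hq hnq hdq
  rw [hq]
  exact div_ne_zero hnq hdq

theorem RegularAt.div {g g' : X × Y → k} {p : X × Y} (hg : (S.prod T).RegularAt g p)
    (hg' : (S.prod T).RegularAt g' p) (hp : g' p ≠ 0) :
    (S.prod T).RegularAt (fun q => g q / g' q) p := by
  let := S.prodTopology T
  obtain ⟨n, hn, d, hd, hdp, h⟩ := regularAt_prod_iff.1 hg
  obtain ⟨n', hn', d', hd', hdp', h'⟩ := regularAt_prod_iff.1 hg'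
  have hnp : n' p ≠ 0 := by
    intro h0
    rw [h'.self_of_nhds, h0, zero_div] at hp
    exact hp rfl
  refine regularAt_prod_iff.2 ⟨n * d', Subalgebra.mul_mem _ hn hd', d * n',
    Subalgebra.mul_mem _ hd hn', mul_ne_zero hdp hnp, ?_⟩
  filter_upwards [h, h'] with q hq hq'
  rw [hq, hq', div_div_div_eq]
  rfl

theorem RegularAt.eval {S : FunctionSheaf k X} {g : X → k} {p : X} (hg : S.RegularAt g p)
    (r : k[X]) : S.RegularAt (fun q => r.eval (g q)) p := by
  induction r using Polynomial.induction_on' with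
  | add r s hr hs =>
    simp only [eval_add]
    exact (S.stalk p).add_mem hr hs
  | monomial n c =>
    simp only [eval_monomial]
    exact (S.stalk p).mul_mem (S.const_mem_stalk c p) ((S.stalk p).pow_mem hg n)

/-- Open sets and regular functions of the line come from polynomials, and polynomials in a regular
function are regular with open nonvanishing locus. -/
theorem isRationalFunction_prod {f : X × Y →. k}
    (hopen : IsOpen[S.prodTopology T] f.Dom) (hdense : @Dense _ (S.prodTopology T) f.Dom)
    (hreg : ∀ p ∈ f.Dom, (S.prod T).RegularAt (totalize f) p) :
    (S.prod T).IsRationalFunction f := by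
  let := S.prodTopology T
  refine ⟨hopen, hdense, ?_, ?_⟩
  · refine continuous_generateFrom_iff.2 ?_
    rintro _ ⟨d, hd, rfl⟩
    obtain ⟨r, hr⟩ := mem_range_aeval_id_iff.1 hd
    let W : Set (X × Y) := {p | p ∈ f.Dom ∧ r.eval (totalize f p) ≠ 0}
    have hW : IsOpen W := by
      rw [isOpen_iff_mem_nhds]
      rintro p ⟨hp, hrp⟩
      filter_upwards [hopen.mem_nhds hp,
        ((hreg p hp).eval r).eventually_ne_zero hrp] with q hq hq'
      exact ⟨hq, hq'⟩
    refine isOpen_induced_iff.2 ⟨W, hW, ?_⟩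
    ext p
    have : p.1 ∈ f.Dom := p.2
    simp only [W, Set.mem_preimage, Set.mem_ofPred_eq, this, true_and, totalize_coe, hr]
  · intro p g hg
    obtain ⟨n, d, hd, hnd⟩ := regularAt_affineLine_iff.1 hg
    rw [← totalize_coe] at hd
    have hp := hreg p p.2
    have h := (hp.eval n).div (hp.eval d) hd
    refine ⟨_, h, Germ.coe_eq.2 ?_⟩
    have hev : ∀ᶠ q : f.Dom in 𝓝 p, d.eval (totalize f q) ≠ 0 :=
      continuous_subtype_val.continuousAt.eventually ((hp.eval d).eventually_ne_zero hd)
    filter_upwards [hev] with q hq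
    rw [← hnd, mul_div_cancel_left₀ _ hq, totalize_coe]
    rfl

end Prod

namespace IsAffineChart

variable {S : FunctionSheaf k X} {V : Set X} {A : Subalgebra k (V → k)}

theorem evalPair_map_algebraMap (χ : A →ₐ[k] k) (b : k) (q : k[X]) :
    evalPair χ b (q.map (algebraMap k A)) = q.eval b := by
  rw [evalPair_eq_eval_map, Polynomial.map_map]
  have : (χ : A →+* k).comp (algebraMap k A) = RingHom.id k := χ.comp_algebraMap
  rw [this, Polynomial.map_id]

theorem exists_fraction_of_mem_tensorOn (hA : S.IsAffineChart V A) {F : X × k → k} {V' : Set X}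
    {W' : Set k} (hF : F ∈ S.tensorOn (affineLine k) V' W') (x : V) (hx : x.1 ∈ V') (b : k)
    (hb : b ∈ W') : ∃ N D : A[X], evalPair (pointEval A x) b D ≠ 0 ∧ ∀ (y : V) (b' : k),
      evalPair (pointEval A y) b' D * F (y, b') = evalPair (pointEval A y) b' N := by
  induction hF using Algebra.adjoin_induction with
  | mem F hF =>
    rcases hF with ⟨g, hg, rfl⟩ | ⟨g, hg, rfl⟩
    · obtain ⟨n, hn, d, hd, hdx, h⟩ := (hA.regularAt_iff g x).1 (hg x hx)
      exact ⟨C ⟨n, hn⟩, C ⟨d, hd⟩, by simpa using hdx, fun y b' => by simpa using h y⟩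
    · obtain ⟨n, d, hdb, h⟩ := regularAt_affineLine_iff.1 (hg b hb)
      exact ⟨n.map (algebraMap k A), d.map (algebraMap k A), by rwa [evalPair_map_algebraMap],
        fun y b' => by simpa [evalPair_map_algebraMap] using h b'⟩
  | algebraMap c =>
    exact ⟨C (algebraMap k A c), 1, by simp, fun y b' => by simp [-pointEval_apply]⟩
  | add F G _ _ hF hG =>
    obtain ⟨N, D, hD, h⟩ := hF
    obtain ⟨N', D', hD', h'⟩ := hG
    refine ⟨N * D' + N' * D, D * D', by rw [map_mul]; exact mul_ne_zero hD hD', fun y b' => ?_⟩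
    simp only [map_add, map_mul, Pi.add_apply, ← h, ← h']
    ring
  | mul F G _ _ hF hG =>
    obtain ⟨N, D, hD, h⟩ := hF
    obtain ⟨N', D', hD', h'⟩ := hG
    refine ⟨N * N', D * D', by rw [map_mul]; exact mul_ne_zero hD hD', fun y b' => ?_⟩
    simp only [map_mul, Pi.mul_apply, ← h, ← h']
    ring

/-- Over an affine chart the open sets of the product with the affine line are unions of
nonvanishing loci of polynomials over the coordinate ring. -/
theorem exists_evalPair_ne_zero_subset (hA : S.IsAffineChart V A) {O : Set (X × k)}
    (hO : IsOpen[S.prodTopology (affineLine k)] O) (x : V) (b : k) (hxb : (x.1, b) ∈ O) :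
    ∃ w : A[X], evalPair (pointEval A x) b w ≠ 0 ∧
      ∀ (y : V) (b' : k), evalPair (pointEval A y) b' w ≠ 0 → (y.1, b') ∈ O := by
  change TopologicalSpace.GenerateOpen _ O at hO
  induction hO with
  | basic O hO =>
    obtain ⟨V', W', hV', hW', F, hF, rfl⟩ := hO
    obtain ⟨hx, hb, hFxb⟩ := hxb
    obtain ⟨s, hs, hsx, hsV⟩ := hA.exists_ne_zero_subset V' hV' x hx
    obtain ⟨q, hqb, hqW⟩ := exists_eval_ne_zero_subset hW' hb
    obtain ⟨N, D, hD, h⟩ := hA.exists_fraction_of_mem_tensorOn hF x hx b hb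
    refine ⟨C ⟨s, hs⟩ * q.map (algebraMap k A) * N, ?_, fun y b' hw => ?_⟩
    · simp only [map_mul, evalPair_C, evalPair_map_algebraMap, ← h]
      exact mul_ne_zero (mul_ne_zero hsx hqb) (mul_ne_zero hD hFxb)
    · simp only [map_mul, evalPair_C, evalPair_map_algebraMap, ← h] at hw
      have h1 := left_ne_zero_of_mul hw
      exact ⟨hsV y (left_ne_zero_of_mul h1), hqW b' (right_ne_zero_of_mul h1),
        right_ne_zero_of_mul (right_ne_zero_of_mul hw)⟩
  | univ => exact ⟨1, by simp, fun _ _ _ => trivial⟩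
  | inter O O' _ _ ih ih' =>
    obtain ⟨w, hw, h⟩ := ih hxb.1
    obtain ⟨w', hw', h'⟩ := ih' hxb.2
    refine ⟨w * w', by rw [map_mul]; exact mul_ne_zero hw hw', fun y b' hy => ?_⟩
    rw [map_mul] at hy
    exact ⟨h y b' (left_ne_zero_of_mul hy), h' y b' (right_ne_zero_of_mul hy)⟩
  | sUnion s _ ih =>
    obtain ⟨O, hO, hxO⟩ := hxb
    obtain ⟨w, hw, h⟩ := ih O hO hxO
    exact ⟨w, hw, fun y b' hy => ⟨O, hO, h y b' hy⟩⟩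

/-- Polynomials over the coordinate ring of a chart are sums of products of regular functions. -/
theorem exists_mem_tensorOn_eq_evalPair (hA : S.IsAffineChart V A) (w : A[X]) :
    ∃ F ∈ S.tensorOn (affineLine k) V Set.univ,
      ∀ (y : V) (b : k), F (y, b) = evalPair (pointEval A y) b w := by
  induction w using Polynomial.induction_on' with
  | add v w hv hw =>
    obtain ⟨F, hF, h⟩ := hv
    obtain ⟨G, hG, h'⟩ := hw
    exact ⟨F + G, Subalgebra.add_mem _ hF hG, fun y b => by simp [h, h']⟩
  | monomial n a =>
    have hfst : extendZero a.1 ∘ Prod.fst ∈ S.tensorOn (affineLine k) V Set.univ :=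
      Algebra.subset_adjoin
        (Or.inl ⟨_, fun x hx => hA.regularAt_extendZero a.2 ⟨x, hx⟩, rfl⟩)
    have hsnd : (id : k → k) ∘ Prod.snd ∈ S.tensorOn (affineLine k) V Set.univ :=
      Algebra.subset_adjoin (Or.inr ⟨id, fun b _ => regularAt_affineLine_id b, rfl⟩)
    refine ⟨_, Subalgebra.mul_mem _ hfst (Subalgebra.pow_mem _ hsnd n), fun y b => ?_⟩
    rw [← C_mul_X_pow_eq_monomial]
    simp

end IsAffineChart

/-- Nonempty open subsets of the product of a variety and the affine line are dense. -/
theorem IsVariety.dense_of_isOpen_prod [Infinite k] {S : FunctionSheaf k X} (hX : S.IsVariety)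
    {O : Set (X × k)} (hO : IsOpen[S.prodTopology (affineLine k)] O) (hne : O.Nonempty) :
    @Dense _ (S.prodTopology (affineLine k)) O := by
  let τ := S.toTopologicalSpace
  let := S.prodTopology (affineLine k)
  have := hX.irreducible
  -- Projections to `X` of open sets are open, and nonempty fibres are cofinite. Irreducibility of
  -- `X` gives a common base point, over which two cofinite fibres meet.
  have hproj : ∀ O : Set (X × k), IsOpen O → IsOpen (Prod.fst '' O) := by
    intro O hO
    rw [isOpen_iff_mem_nhds]
    rintro _ ⟨⟨x, b⟩, hxb, rfl⟩
    obtain ⟨V, A, hA, hx⟩ := hX.exists_isAffineChart x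
    obtain ⟨w, hw, hwO⟩ := hA.exists_evalPair_ne_zero_subset hO ⟨x, hx⟩ b hxb
    have hs := hA.isOpen_ne_zero (w.eval (algebraMap k A b)).1 (Subtype.property _)
    refine Filter.mem_of_superset (hs.mem_nhds ⟨⟨x, hx⟩, ?_, rfl⟩) ?_
    · rw [evalPair_eq_apply_eval] at hw
      exact hw
    · rintro _ ⟨y, hy, rfl⟩
      refine ⟨(y.1, b), hwO y b ?_, rfl⟩
      rw [evalPair_eq_apply_eval]
      exact hy
  have hfib : ∀ (O : Set (X × k)), IsOpen O → ∀ x ∈ Prod.fst '' O, {b | (x, b) ∉ O}.Finite := by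
    rintro O hO _ ⟨⟨x, b⟩, hxb, rfl⟩
    obtain ⟨V, A, hA, hx⟩ := hX.exists_isAffineChart x
    obtain ⟨w, hw, hwO⟩ := hA.exists_evalPair_ne_zero_subset hO ⟨x, hx⟩ b hxb
    have hw0 : w.map (pointEval A ⟨x, hx⟩ : A →+* k) ≠ 0 := by
      intro h0
      rw [evalPair_eq_eval_map, h0, eval_zero] at hw
      exact hw rfl
    refine (finite_setOfPred_isRoot hw0).subset fun b' hb' => ?_
    by_contra hne
    exact hb' (hwO ⟨x, hx⟩ b' (by rw [evalPair_eq_eval_map]; exact hne))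
  rw [dense_iff_inter_open]
  intro O' hO' hne'
  obtain ⟨x, hx', hx⟩ := nonempty_preirreducible_inter (hproj O' hO') (hproj O hO)
    (hne'.image _) (hne.image _)
  obtain ⟨b, hb⟩ := ((hfib O' hO' x hx').union (hfib O hO x hx)).infinite_compl.nonempty
  simp only [Set.mem_compl_iff, Set.mem_union, Set.mem_ofPred_eq, not_or, not_not] at hb
  exact ⟨(x, b), hb.1, hb.2⟩

end FunctionSheaf

/-! ### From one chart to the variety -/

theorem theorem4p6 {k : Type*} [Field k] [IsAlgClosed k]
    (hk : Cardinal.continuum < Cardinal.mk k)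
    {X : Type*} (S : FunctionSheaf k X) (hX : S.IsVariety) (hN : S.IsNormal)
    (f : X × k →. k)
    (hopen : IsOpen[(S.prod (FunctionSheaf.affineLine k)).toTopologicalSpace] f.Dom)
    (hne : f.Dom.Nonempty)
    (hslice : ∀ (a : X) (b : k), (a, b) ∈ f.Dom →
      (FunctionSheaf.affineLine k).IsRationalFunction (f.sliceFst a) ∧
        S.IsRationalFunction (f.sliceSnd b)) :
    (S.prod (FunctionSheaf.affineLine k)).IsRationalFunction f := by
  have hk' : Cardinal.aleph0 < Cardinal.mk k := Cardinal.aleph0_lt_continuum.trans hk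
  have : Infinite k := IsAlgClosed.instInfinite
  refine FunctionSheaf.isRationalFunction_prod hopen (hX.dense_of_isOpen_prod hopen hne) ?_
  rintro ⟨x, b⟩ hxb
  obtain ⟨V, A, hA, hx⟩ := hX.exists_isAffineChart x
  have := hA.isDomain hX.irreducible ⟨x, hx⟩
  have := hA.isIntegrallyClosed hk' hX.irreducible hN
  have := hA.finiteType
  -- Points of the chart are identified with characters of `A`, which carries `f` to the algebraic
  -- setting.
  let ev : V ≃ (A →ₐ[k] k) := Equiv.ofBijective _ hA.bijective
  have hev : ∀ y, ev y = FunctionSheaf.pointEval A y := fun y => rfl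
  let U : Set ((A →ₐ[k] k) × k) := {p | ((ev.symm p.1 : X), p.2) ∈ f.Dom}
  let F : (A →ₐ[k] k) → k → k := fun χ b => FunctionSheaf.totalize f (ev.symm χ, b)
  have hU : ∀ (y : V) b, (ev y, b) ∈ U ↔ (y.1, b) ∈ f.Dom := fun y b => by simp [U]
  have hF : ∀ (y : V) b, F (ev y) b = FunctionSheaf.totalize f (y.1, b) := fun y b => by simp [F]
  have hsep : SeparatelyRegular U F := by
    refine ⟨fun χ b hχ => ?_, fun χ b hχ => ?_, fun χ b hχ => ?_⟩ <;>
      obtain ⟨y, rfl⟩ := ev.surjective χ <;> rw [hU] at hχ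
    · obtain ⟨w, hw, hwU⟩ := hA.exists_evalPair_ne_zero_subset hopen y b hχ
      refine ⟨w, hw, fun χ' b' hw' => ?_⟩
      obtain ⟨y', rfl⟩ := ev.surjective χ'
      exact (hU y' b').2 (hwU y' b' hw')
    · obtain ⟨n, hn, d, hd, hdy, h⟩ :=
        (hA.regularAt_iff _ y).1 ((hslice y b hχ).2.regularAt (x := y.1) hχ)
      refine ⟨⟨n, hn⟩, ⟨d, hd⟩, hdy, fun χ' _ => ?_⟩
      obtain ⟨y', rfl⟩ := ev.surjective χ'
      rw [hF]
      exact h y'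
    · obtain ⟨n, d, hdb, h⟩ :=
        FunctionSheaf.regularAt_affineLine_iff.1 ((hslice y b hχ).1.regularAt (x := b) hχ)
      refine ⟨n, d, hdb, fun b' _ => ?_⟩
      rw [hF]
      exact h b'
  obtain ⟨n, d, hd, hnd⟩ := hsep.exists_eq_div hk' ((hU ⟨x, hx⟩ b).2 hxb)
  obtain ⟨N, hN', hNn⟩ := hA.exists_mem_tensorOn_eq_evalPair n
  obtain ⟨D, hD', hDd⟩ := hA.exists_mem_tensorOn_eq_evalPair d
  have hanti := FunctionSheaf.tensorOn_anti S (FunctionSheaf.affineLine k)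
    (Set.singleton_subset_iff.2 hx) (Set.subset_univ {b})
  have hDx : D (x, b) ≠ 0 := by
    rw [hDd ⟨x, hx⟩ b]
    exact hd
  let := S.prodTopology (FunctionSheaf.affineLine k)
  refine FunctionSheaf.regularAt_prod_iff.2 ⟨N, hanti hN', D, hanti hD', hDx, ?_⟩
  filter_upwards [hopen.mem_nhds hxb, FunctionSheaf.eventually_prodTopology S _ (x, b) hA.isOpen
    (@isOpen_univ _ (FunctionSheaf.affineLine k).toTopologicalSpace) hD' hx trivial hDx]
    with q hq hq'
  obtain ⟨y, b'⟩ := q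
  obtain ⟨hy, -, hDy⟩ := hq'
  have h := hnd (ev ⟨y, hy⟩) b' ((hU ⟨y, hy⟩ b').2 hq)
  rw [hF, hev, ← hNn, ← hDd] at h
  rw [← h, mul_div_cancel_left₀ _ hDy]
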